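/- Let $\mathbb K$ be a field of characteristic $0$ and let $q\in\mathbb K^\times$ be such that $q=1$ or $q$ is not a root of unity. For an operator $R$ write $R(x_i\otimes x_j)=x_k\otimes x_l\,R^{kl}_{ij}$ (summation over repeated indices). An operator $R$ is called \emph{closed} if there is $S$ with $R^{jn}_{im}S^{mk}_{nl}=S^{jn}_{im}R^{mk}_{nl}=\delta_i^k\delta_l^j$ (the same definition is used for operators between different spaces). An \emph{even Hecke operator} on a finite-dimensional space $V_0$ is a closed operator $R$ on $V_0\otimes V_0$ satisfying $(R+1)(R-q)=0$ and the Yang--Baxter equation, such that $\Lambda=T(V_0)/\langle \operatorname{Im}(R+1)\rangle$ is finite-dimensional; its \emph{rank} is the degree of the highest non-vanishing component of $\Lambda$. An operator $R$ is an \emph{odd Hecke operator} of rank $s$ if it is invertible and $-qR^{-1}$ is an even Hecke operator of rank $s$. Let $R_e$ be an even Hecke operator of rank $r$ on $V_0$, $\dim V_0=m$, let $R_o$ be an odd Hecke operator of rank $s$ on $V_1$, $\dim V_1=n$, and let $P:V_0\otimes V_1\to V_1\otimes V_0$ be an invertible closed operator such that $$P_1P_2\,(R_e)_1=(R_e)_2\,P_1P_2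 \ \text{ on } V_0\otimes V_0\otimes V_1,\qquad P_2P_1\,(R_o)_2=(R_o)_1\,P_2P_1\ \text{ on } V_0\otimes V_1\otimes V_1 .$$ Let $W=V_0\oplus V_1$ be the super space with even part $V_0$ and odd part $V_1$, and let $R$ be the operator on $W\otimes W$ (the Hecke sum) equal to $R_e$ on $V_0\otimes V_0$, to $R_o$ on $V_1\otimes V_1$, to $P$ on $V_0\otimes V_1$, and to $qP^{-1}+(q-1)\,\mathrm{id}$ on $V_1\otimes V_0$. Let $H$ be the algebra generated by $z^j_i,t^j_i$ ($1\le i,j\le m+n$) with relations $$(-1)^{\hat s(\hat i+\hat p)}R^{kl}_{ps}z^p_iz^s_j=(-1)^{\hat l(\hat q+\hat k)}z^k_qz^l_nR^{qn}_{ij},\qquad \sum_k(-1)^{\hat i(\hat k+1)}z^j_kt^k_i=\sum_k(-1)^{\hat k(\hat j+1)}t^j_kz^k_i=\delta^j_i ,$$ where $\hat i$ is the parity of the $i$-th basis vector. Let $A$ be the even-even block of $Z=(z^j_i)$ and $V$ the odd-odd block of $T=(t^j_i)$. Let $S_e,S_o$ be the skew inverses of $R_e,R_o$ (the operators $S$ in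 the definition of closedness), and put $F_e{}_i^j=S_e{}_{li}^{lj}$, $G_o{}_i^j=S_o{}_{il}^{jl}$. Let $R_w$ denote the operator of $w\in\mathfrak S_k$ on the $k$-th tensor power, i.e. the product of the $R_i$ along a reduced word of $w$, and let $$\Phi_e=\frac{\sum_{w\in\mathfrak S_r}(-q)^{-\ell(w)}(R_e)_w}{\sum_{w\in\mathfrak S_r}q^{-\ell(w)}},\qquad \Phi_o=\frac{\sum_{w\in\mathfrak S_s}(R_o)_w}{\sum_{w\in\mathfrak S_s}q^{\ell(w)}}$$ be the images of the central primitive idempotents of the Hecke algebras belonging to the partitions $(1^r)$ and $(s)$; let $\overline{\Phi_o}{}^{j_1\ldots j_s}_{k_1\ldots k_s}=\Phi_o{}^{j_s\ldots j_1}_{k_s\ldots k_1}$. For multi-indices put $F_e{}_J^I=\prod_aF_e{}_{j_a}^{i_a}$, $G_o{}_J^I=\prod_aG_o{}_{j_a}^{i_a}$, $A_I^K=A_{i_1}^{k_1}\cdots A_{i_r}^{k_r}$, $V_I^K=V_{i_1}^{k_1}\cdots V_{i_s}^{k_s}$, and define the quantum determinants (with the scalar normalization shown) $$\det\nolimits_qA=q^{\frac{r(r+1)}2}F_e{}_J^I\,\Phi_e{}_K^J\,A_I^K,\qquad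 \det\nolimits_qV=q^{\frac{s(s+1)}2}G_o{}_J^I\,\overline{\Phi_o}{}_K^J\,V_I^K .$$ Then $\det_qA$ and $\det_qV$ commute in $H$. -/

import Mathlib

open scoped Kronecker

namespace QuantumBer

/-! Conventions.  A linear map between tensor products of two based spaces is the matrix
`R (k, l) (i, j) = R^{kl}_{ij}` of `R (x_i ⊗ x_j) = ∑ x_k ⊗ x_l R^{kl}_{ij}`: row indices are upper
indices, column indices are lower indices.  A matrix of algebra elements `z^j_i` is written
`z j i`, upper index first. -/

section Operators

variable {K : Type*} [Field K]

/-- `M ⊗ id` on a triple tensor product. -/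
def onLeft {α β γ δ : Type*} (ε : Type*) [DecidableEq ε]
    (M : Matrix (α × β) (γ × δ) K) : Matrix (α × β × ε) (γ × δ × ε) K :=
  (M ⊗ₖ (1 : Matrix ε ε K)).submatrix (Equiv.prodAssoc α β ε).symm (Equiv.prodAssoc γ δ ε).symm

/-- `id ⊗ M` on a triple tensor product. -/
def onRight {α β γ δ : Type*} (ε : Type*) [DecidableEq ε]
    (M : Matrix (α × β) (γ × δ) K) : Matrix (ε × α × β) (ε × γ × δ) K :=
  (1 : Matrix ε ε K) ⊗ₖ M

/-- `S` is the skew inverse of `R : X_γ ⊗ X_δ → X_α ⊗ X_β`: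
`R^{jn}_{im} S^{mk}_{nl} = δ_i^k δ^j_l` and `S^{jn}_{im} R^{mk}_{nl} = δ_i^k δ^j_l`. -/
def IsSkewInverse {α β γ δ : Type*} [Fintype α] [Fintype β] [Fintype γ] [Fintype δ]
    [DecidableEq α] [DecidableEq β] [DecidableEq γ] [DecidableEq δ]
    (R : Matrix (α × β) (γ × δ) K) (S : Matrix (δ × γ) (β × α) K) : Prop :=
  (∀ (i k : γ) (j l : α), ∑ m, ∑ n, R (j, n) (i, m) * S (m, k) (n, l) =
      (if i = k then 1 else 0) * (if j = l then 1 else 0)) ∧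
  (∀ (i k : β) (j l : δ), ∑ m, ∑ n, S (j, n) (i, m) * R (m, k) (n, l) =
      (if i = k then 1 else 0) * (if j = l then 1 else 0))

/-- An operator is closed if it has a skew inverse. -/
def IsClosedOp {α β γ δ : Type*} [Fintype α] [Fintype β] [Fintype γ] [Fintype δ]
    [DecidableEq α] [DecidableEq β] [DecidableEq γ] [DecidableEq δ]
    (R : Matrix (α × β) (γ × δ) K) : Prop :=
  ∃ S, IsSkewInverse R S

variable {ι : Type*} [Fintype ι] [DecidableEq ι]

open Classical in
/-- The (unique) skew inverse of a closed operator; zero if the operator is not closed. -/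
noncomputable def skewInv (R : Matrix (ι × ι) (ι × ι) K) : Matrix (ι × ι) (ι × ι) K :=
  if h : IsClosedOp R then h.choose else 0

/-- The defining relations `x_i x_j R^{ij}_{kl} = - x_k x_l` of the quantum exterior algebra. -/
inductive ExteriorRel (R : Matrix (ι × ι) (ι × ι) K) : FreeAlgebra K ι → FreeAlgebra K ι → Prop
  | rel (k l : ι) : ExteriorRel R
      (∑ i, ∑ j, R (i, j) (k, l) • (FreeAlgebra.ι K i * FreeAlgebra.ι K j))
      (-(FreeAlgebra.ι K k * FreeAlgebra.ι K l))

/-- The quantum exterior algebra `Λ = T(V) / (Im (R + 1))`. -/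
abbrev QuantumExterior (R : Matrix (ι × ι) (ι × ι) K) : Type _ := RingQuot (ExteriorRel R)

/-- The homogeneous component of degree `k` of `Λ`: the span of the products of `k` generators. -/
noncomputable def exteriorPart (R : Matrix (ι × ι) (ι × ι) K) (k : ℕ) :
    Submodule K (QuantumExterior R) :=
  Submodule.span K (Set.range fun i : ι =>
    RingQuot.mkAlgHom K (ExteriorRel R) (FreeAlgebra.ι K i)) ^ k

/-- Even Hecke operators: the Hecke equation `(R + 1)(R - q) = 0`, the Yang-Baxter equation,
closedness, and finite dimension of the quantum exterior algebra. -/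
structure IsEvenHecke (q : K) (R : Matrix (ι × ι) (ι × ι) K) : Prop where
  hecke : (R + 1) * (R - q • (1 : Matrix (ι × ι) (ι × ι) K)) = 0
  yangBaxter : onLeft ι R * onRight ι R * onLeft ι R = onRight ι R * onLeft ι R * onRight ι R
  closed : IsClosedOp R
  finite : Module.Finite K (QuantumExterior R)

/-- The even Hecke operator `R` has rank `r`: the highest nonzero component of `Λ` has
degree `r`. -/
def HasEvenRank (R : Matrix (ι × ι) (ι × ι) K) (r : ℕ) : Prop :=
  IsGreatest {k : ℕ | exteriorPart R k ≠ ⊥} r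

/-- Odd Hecke operators: `R` is invertible and `-q R⁻¹` is an even Hecke operator. -/
def IsOddHecke (q : K) (R : Matrix (ι × ι) (ι × ι) K) : Prop :=
  IsUnit R ∧ IsEvenHecke q (-(q • R⁻¹))

/-- The rank of an odd Hecke operator `R` is the rank of `-q R⁻¹`. -/
def HasOddRank (q : K) (R : Matrix (ι × ι) (ι × ι) K) (s : ℕ) : Prop :=
  HasEvenRank (-(q • R⁻¹)) s

/-- The operator `R` acting on the (zero-based) tensor factors `i`, `i + 1` of `V^{⊗ r}`. -/
def opAt (R : Matrix (ι × ι) (ι × ι) K) (r i : ℕ) : Matrix (Fin r → ι) (Fin r → ι) K :=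
  fun J I =>
    if h : i + 1 < r then
      if ∀ a : Fin r, a.val ≠ i → a.val ≠ i + 1 → J a = I a then
        R (J ⟨i, by omega⟩, J ⟨i + 1, h⟩) (I ⟨i, by omega⟩, I ⟨i + 1, h⟩)
      else 0
    else 0

/-- The descending product `R_{k-1} R_{k-2} ⋯ R_{k-i}` of `i` factors on `V^{⊗ r}`. -/
def descending (R : Matrix (ι × ι) (ι × ι) K) (r k : ℕ) : ℕ → Matrix (Fin r → ι) (Fin r → ι) K
  | 0 => 1
  | i + 1 => descending R r k i * opAt R r (k - 1 - i)

/-- `∑_{w ∈ 𝔖_r} c^{ℓ(w)} R_w` on `V^{⊗ r}`.  Every permutation of `{0, …, r-1}` has exactly one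
reduced word of the form `v_0 v_1 ⋯ v_{r-1}` with `v_k = s_{k-1} s_{k-2} ⋯ s_{k-i_k}`,
`0 ≤ i_k ≤ k`, and the sum over these words factorizes. -/
def heckeSum (R : Matrix (ι × ι) (ι × ι) K) (c : K) (r : ℕ) :
    Matrix (Fin r → ι) (Fin r → ι) K :=
  ((List.range r).map fun k => ∑ i ∈ Finset.range (k + 1), c ^ i • descending R r k i).prod

/-- The quantum factorial `[r]_x! = ∏_{k < r} (1 + x + ⋯ + x^k) = ∑_{w ∈ 𝔖_r} x^{ℓ(w)}`. -/
def qFactorial (x : K) (r : ℕ) : K :=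
  ∏ k ∈ Finset.range r, ∑ i ∈ Finset.range (k + 1), x ^ i

/-- The operator `R_{(1,…,1)}` on `V^{⊗ r}`: the image of the central primitive idempotent
`(∑_w q^{-ℓ(w)})⁻¹ ∑_w (-q)^{-ℓ(w)} T_w` of the Hecke algebra `ℋ_r`. -/
def antisymmetrizer (q : K) (R : Matrix (ι × ι) (ι × ι) K) (r : ℕ) :
    Matrix (Fin r → ι) (Fin r → ι) K :=
  (qFactorial q⁻¹ r)⁻¹ • heckeSum R (-q⁻¹) r

/-- The operator `R_{(s)}` on `V^{⊗ s}`: the image of the central primitive idempotent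
`(∑_w q^{ℓ(w)})⁻¹ ∑_w T_w` of the Hecke algebra `ℋ_s`. -/
def symmetrizer (q : K) (R : Matrix (ι × ι) (ι × ι) K) (s : ℕ) :
    Matrix (Fin s → ι) (Fin s → ι) K :=
  (qFactorial q s)⁻¹ • heckeSum R 1 s

/-- Reversal of multi-indices: `Φ̄^{j_1 … j_s}_{k_1 … k_s} = Φ^{j_s … j_1}_{k_s … k_1}`. -/
def reversed {s : ℕ} (Φ : Matrix (Fin s → ι) (Fin s → ι) K) :
    Matrix (Fin s → ι) (Fin s → ι) K :=
  fun J L => Φ (fun a => J a.rev) (fun a => L a.rev)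

/-- `F_i^j = S_{li}^{lj}` for the skew inverse `S` of `R`. -/
noncomputable def traceF (R : Matrix (ι × ι) (ι × ι) K) : Matrix ι ι K :=
  fun j i => ∑ l, skewInv R (l, j) (l, i)

/-- `G_i^j = S_{il}^{jl}` for the skew inverse `S` of `R`. -/
noncomputable def traceG (R : Matrix (ι × ι) (ι × ι) K) : Matrix ι ι K :=
  fun j i => ∑ l, skewInv R (j, l) (i, l)

/-- The contraction `F_J^I Φ_K^J A_I^K` over all multi-indices of length `r`, where
`F_J^I = F_{j_1}^{i_1} ⋯ F_{j_r}^{i_r}` and `A_I^K = A_{i_1}^{k_1} ⋯ A_{i_r}^{k_r}`. -/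
noncomputable def contraction {H : Type*} [Ring H] [Algebra K H] {r : ℕ} (F : Matrix ι ι K)
    (Φ : Matrix (Fin r → ι) (Fin r → ι) K) (A : ι → ι → H) : H :=
  ∑ I : Fin r → ι, ∑ J : Fin r → ι, ∑ L : Fin r → ι,
    ((∏ a, F (I a) (J a)) * Φ J L) • (List.ofFn fun a => A (L a) (I a)).prod

end Operators

section SuperGroup

variable {K : Type*} [Field K]

/-- The operator `R` on `V ⊗ V`, `V = V_0 ⊕ V_1`, glued from `R_e`, `R_o`,
`P : V_0 ⊗ V_1 → V_1 ⊗ V_0` and `Q : V_1 ⊗ V_0 → V_0 ⊗ V_1`, with `(q - 1) id` as the diagonal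
block on `V_1 ⊗ V_0`. -/
def gluedOp {α β : Type*} [DecidableEq α] [DecidableEq β] (q : K)
    (Re : Matrix (α × α) (α × α) K) (Ro : Matrix (β × β) (β × β) K)
    (P : Matrix (β × α) (α × β) K) (Q : Matrix (α × β) (β × α) K) :
    Matrix ((α ⊕ β) × (α ⊕ β)) ((α ⊕ β) × (α ⊕ β)) K
  | (.inl k, .inl l), (.inl i, .inl j) => Re (k, l) (i, j)
  | (.inl k, .inr l), (.inr i, .inl j) => Q (k, l) (i, j)
  | (.inr k, .inl l), (.inl i, .inr j) => P (k, l) (i, j)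
  | (.inr k, .inl l), (.inr i, .inl j) => if k = i ∧ l = j then q - 1 else 0
  | (.inr k, .inr l), (.inr i, .inr j) => Ro (k, l) (i, j)
  | _, _ => 0

/-- The parity of a basis vector of `V_0 ⊕ V_1`. -/
def parity {α β : Type*} : α ⊕ β → ℕ
  | .inl _ => 0
  | .inr _ => 1

/-- The generators `z^j_i` and `t^j_i`; the first argument is the upper index. -/
inductive Gen (ι : Type*)
  | z (up low : ι) : Gen ι
  | t (up low : ι) : Gen ι

variable {α β : Type*} [Fintype α] [Fintype β] [DecidableEq α] [DecidableEq β]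

/-- The free algebra generator `z^j_i`. -/
def zFree (K : Type*) [Field K] {α β : Type*} (j i : α ⊕ β) : FreeAlgebra K (Gen (α ⊕ β)) :=
  FreeAlgebra.ι K (Gen.z j i)

/-- The free algebra generator `t^j_i`. -/
def tFree (K : Type*) [Field K] {α β : Type*} (j i : α ⊕ β) : FreeAlgebra K (Gen (α ⊕ β)) :=
  FreeAlgebra.ι K (Gen.t j i)

/-- The defining relations of `H`: the quadratic relations
`(-1)^{ŝ(î+p̂)} R^{kl}_{ps} z^p_i z^s_j = (-1)^{l̂(q̂+k̂)} z^k_q z^l_n R^{qn}_{ij}`, and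
`∑_k (-1)^{î(k̂+1)} z^j_k t^k_i = ∑_k (-1)^{k̂(ĵ+1)} t^j_k z^k_i = δ^j_i`. -/
inductive HopfRel (R : Matrix ((α ⊕ β) × (α ⊕ β)) ((α ⊕ β) × (α ⊕ β)) K) :
    FreeAlgebra K (Gen (α ⊕ β)) → FreeAlgebra K (Gen (α ⊕ β)) → Prop
  | zz (k l i j : α ⊕ β) : HopfRel R
      (∑ p, ∑ s, ((-1) ^ (parity s * (parity i + parity p)) * R (k, l) (p, s)) •
        (zFree K p i * zFree K s j))
      (∑ p, ∑ s, ((-1) ^ (parity l * (parity p + parity k)) * R (p, s) (i, j)) •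
        (zFree K k p * zFree K l s))
  | zt (j i : α ⊕ β) : HopfRel R
      (∑ k, ((-1 : K) ^ (parity i * (parity k + 1))) • (zFree K j k * tFree K k i))
      (if j = i then 1 else 0)
  | tz (j i : α ⊕ β) : HopfRel R
      (∑ k, ((-1 : K) ^ (parity k * (parity j + 1))) • (tFree K j k * zFree K k i))
      (if j = i then 1 else 0)

/-- The function algebra `H` on the matrix quantum super group of `R`: the Hopf envelope of the
super bialgebra generated by the `z^j_i`. -/
abbrev HopfEnvelope (R : Matrix ((α ⊕ β) × (α ⊕ β)) ((α ⊕ β) × (α ⊕ β)) K) : Type _ :=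
  RingQuot (HopfRel R)

/-- The even-even block `A` of `Z = (z^j_i)` in `H`. -/
noncomputable def blockA (R : Matrix ((α ⊕ β) × (α ⊕ β)) ((α ⊕ β) × (α ⊕ β)) K) (j i : α) :
    HopfEnvelope R :=
  RingQuot.mkAlgHom K (HopfRel R) (zFree K (.inl j) (.inl i))

/-- The odd-odd block `V` of `T = (t^j_i)` in `H`. -/
noncomputable def blockV (R : Matrix ((α ⊕ β) × (α ⊕ β)) ((α ⊕ β) × (α ⊕ β)) K) (j i : β) :
    HopfEnvelope R :=
  RingQuot.mkAlgHom K (HopfRel R) (tFree K (.inr j) (.inr i))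

/-- `det_q A = q^{r(r+1)/2} F_e{}_J^I Φ_e{}_K^J A_I^K`. -/
noncomputable def detA (q : K) (Re : Matrix (α × α) (α × α) K) (r : ℕ)
    (R : Matrix ((α ⊕ β) × (α ⊕ β)) ((α ⊕ β) × (α ⊕ β)) K) : HopfEnvelope R :=
  q ^ (r * (r + 1) / 2) • contraction (traceF Re) (antisymmetrizer q Re r) (blockA R)

/-- `det_q V = q^{s(s+1)/2} G_o{}_J^I Φ̄_o{}_K^J V_I^K`. -/
noncomputable def detV (q : K) (Ro : Matrix (β × β) (β × β) K) (s : ℕ)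
    (R : Matrix ((α ⊕ β) × (α ⊕ β)) ((α ⊕ β) × (α ⊕ β)) K) : HopfEnvelope R :=
  q ^ (s * (s + 1) / 2) • contraction (traceG Ro) (reversed (symmetrizer q Ro s)) (blockV R)

end SuperGroup

end QuantumBer

/-! Regard `P` as a matrix `L` over `V_0` with entries in `End V_1`. Sandwiching the quadratic
relations between an odd row and an odd column of `T` cancels one `z` on each side. Between the
blocks `A` and `V` only the part `P` of `R` survives: `V L A = A L V` (`tGen_mul_zGen`,
`blockV_mul_blockA`).

Such a relation makes quantum traces commute (`TraceSystem.commute_trace`). With `L' = L⁻¹`, the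
identity `∑ F^i_j L'^j_l L^p_i = F^p_l` allows `L'` and `L` to be inserted around `A` inside the
`F`-trace. The exchange relation then carries `V` past `A`, and the corresponding identity for `G`
removes `L` and `L'`. The weights `F_e` and `G_o` satisfy these identities because `P` intertwines
`R_e` and `R_o` (`isTraceWeight_of_intertwines`). Everything passes to tensor powers. Since `Φ_e`
commutes with the tensor power of `L`, the product `F_e^{⊗r} Φ_e` is again a weight, and
interchanging the roles of `A` and `V` gives the same for `G_o` and the reversed `Φ_o`
(`TraceSystem.tensorPow`, `TraceSystem.flip`). Up to scalars the determinants are the resulting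
traces.

The weight `G_o` requires `R_o` to be closed, whereas the hypothesis gives closedness of `R' = -q
R_o⁻¹`. The Hecke equation gives `R_o = (q - 1) - R'`. The partial transpose of the identity has
rank one, so `R_o` is closed once `(q - 1) tr F' ≠ 1`, where `F'` is the weight of `R'`
(`isClosedOp_smul_one_sub`). Antisymmetrizing a top-degree alternating function with one extra
letter gives zero, and tracing out that letter yields `tr F' = q⁻¹ + ⋯ + q⁻ˢ` (`trace_traceF`).
Hence `(q - 1) tr F' = 1 - q⁻ˢ`, which is never `1`. -/

namespace QuantumBer

set_option linter.unusedSectionVars false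

/-! ### Tensor powers of matrices with noncommuting entries, and scalar operators commuting with
them. -/

section TensorPowers

variable {K : Type*} [Field K] {B : Type*} [Ring B] [Algebra K B]
variable {α : Type*} [Fintype α] [DecidableEq α]

/-- The tensor power `X_1 X_2 ⋯ X_r` of a matrix with noncommuting entries. -/
def tensorPow (X : Matrix α α B) (r : ℕ) : Matrix (Fin r → α) (Fin r → α) B :=
  fun I J => (List.ofFn fun a => X (I a) (J a)).prod

/-- The tensor power `X_r ⋯ X_2 X_1` with the entries multiplied in the opposite order. -/
def tensorPowRev (X : Matrix α α B) (r : ℕ) : Matrix (Fin r → α) (Fin r → α) B :=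
  fun I J => (List.ofFn fun a => X (I a) (J a)).reverse.prod

theorem sum_fin_succ_arrow {M : Type*} [AddCommMonoid M] {r : ℕ} (f : (Fin (r + 1) → α) → M) :
    ∑ I, f I = ∑ i, ∑ I : Fin r → α, f (Fin.cons i I) := by
  rw [← (Fin.consEquiv fun _ : Fin (r + 1) => α).sum_comp, Fintype.sum_prod_type]
  rfl

@[simp] theorem tensorPow_zero (X : Matrix α α B) (I J : Fin 0 → α) : tensorPow X 0 I J = 1 := by
  simp [tensorPow]

@[simp] theorem tensorPowRev_zero (X : Matrix α α B) (I J : Fin 0 → α) :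
    tensorPowRev X 0 I J = 1 := by
  simp [tensorPowRev]

@[simp] theorem tensorPow_cons (X : Matrix α α B) {r : ℕ} (i j : α) (I J : Fin r → α) :
    tensorPow X (r + 1) (Fin.cons i I) (Fin.cons j J) = X i j * tensorPow X r I J := by
  simp [tensorPow]

@[simp] theorem tensorPowRev_cons (X : Matrix α α B) {r : ℕ} (i j : α) (I J : Fin r → α) :
    tensorPowRev X (r + 1) (Fin.cons i I) (Fin.cons j J) = tensorPowRev X r I J * X i j := by
  simp [tensorPowRev]

theorem one_apply_cons {r : ℕ} (i j : α) (I J : Fin r → α) :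
    (1 : Matrix (Fin (r + 1) → α) (Fin (r + 1) → α) B) (Fin.cons i I) (Fin.cons j J) =
      (1 : Matrix α α B) i j * (1 : Matrix (Fin r → α) (Fin r → α) B) I J := by
  simp only [Matrix.one_apply, Fin.cons_inj]
  split_ifs <;> simp_all

theorem commute_tensorPow {X : Matrix α α B} {b : B} (h : ∀ i j, Commute b (X i j)) :
    ∀ (r : ℕ) (I J : Fin r → α), Commute b (tensorPow X r I J)
  | 0, I, J => by simp
  | r + 1, I, J => by
    induction I using Fin.consCases
    induction J using Fin.consCases
    rw [tensorPow_cons]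
    exact (h _ _).mul_right (commute_tensorPow h r _ _)

theorem semiconjBy_tensorPow {X Y : Matrix α α B} {b : B} (h : ∀ i j, SemiconjBy b (X i j) (Y i j)) :
    ∀ (r : ℕ) (I J : Fin r → α), SemiconjBy b (tensorPow X r I J) (tensorPow Y r I J)
  | 0, I, J => by simp
  | r + 1, I, J => by
    induction I using Fin.consCases
    induction J using Fin.consCases
    rw [tensorPow_cons, tensorPow_cons]
    exact (h _ _).mul_right (semiconjBy_tensorPow h r _ _)

theorem tensorPow_mul {X Y : Matrix α α B} (h : ∀ i j k l, Commute (X i j) (Y k l)) (r : ℕ) :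
    tensorPow (X * Y) r = tensorPow X r * tensorPow Y r := by
  induction r with
  | zero => ext I J; simp [Matrix.mul_apply]
  | succ r ih =>
    ext I J
    induction I using Fin.consCases
    induction J using Fin.consCases
    rename_i i I j J
    rw [tensorPow_cons, ih, Matrix.mul_apply, Matrix.mul_apply, Matrix.mul_apply,
      sum_fin_succ_arrow, Finset.sum_mul_sum]
    refine Finset.sum_congr rfl fun u _ => Finset.sum_congr rfl fun U _ => ?_
    rw [tensorPow_cons, tensorPow_cons, mul_assoc, mul_assoc, ← mul_assoc (Y u j),
      ← mul_assoc (tensorPow X r I U),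
      (commute_tensorPow (fun a b => (h a b u j).symm) r I U).eq]

theorem tensorPow_map {C : Type*} [Ring C] (f : B →+* C) (X : Matrix α α B) (r : ℕ)
    (I J : Fin r → α) : tensorPow (X.map f) r I J = f (tensorPow X r I J) := by
  simp [tensorPow, map_list_prod, List.map_ofFn, Function.comp_def]

/-- The reversed order nests the products, so the inner positions collapse first and no entries need
to commute. This is why inverses of tensor powers are `tensorPowRev`. -/
theorem tensorPow_mul_tensorPowRev {X Y : Matrix α α B} (h : X * Y = 1) (r : ℕ) :
    tensorPow X r * tensorPowRev Y r = 1 := by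
  induction r with
  | zero => ext I J; simp [Matrix.mul_apply, Matrix.one_apply, Subsingleton.elim I J]
  | succ r ih =>
    ext I J
    induction I using Fin.consCases
    induction J using Fin.consCases
    rename_i i I j J
    rw [one_apply_cons, ← h, Matrix.mul_apply, sum_fin_succ_arrow, Matrix.mul_apply,
      Finset.sum_mul]
    refine Finset.sum_congr rfl fun u _ => ?_
    have : ∀ U, tensorPow X (r + 1) (Fin.cons i I) (Fin.cons u U) *
        tensorPowRev Y (r + 1) (Fin.cons u U) (Fin.cons j J) =
        X i u * (tensorPow X r I U * tensorPowRev Y r U J) * Y u j := fun U => by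
      rw [tensorPow_cons, tensorPowRev_cons]; simp only [mul_assoc]
    simp_rw [this]
    rw [← Finset.sum_mul, ← Finset.mul_sum, ← Matrix.mul_apply, ih, Matrix.one_apply]
    split_ifs <;> simp

theorem tensorPowRev_mul_tensorPow {X Y : Matrix α α B} (h : Y * X = 1) (r : ℕ) :
    tensorPowRev Y r * tensorPow X r = 1 := by
  induction r with
  | zero => ext I J; simp [Matrix.mul_apply, Matrix.one_apply, Subsingleton.elim I J]
  | succ r ih =>
    ext I J
    induction I using Fin.consCases
    induction J using Fin.consCases
    rename_i i I j J
    rw [one_apply_cons, ← ih, Matrix.mul_apply, sum_fin_succ_arrow, Finset.sum_comm,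
      Matrix.mul_apply, Finset.mul_sum]
    refine Finset.sum_congr rfl fun U _ => ?_
    have : ∀ u, tensorPowRev Y (r + 1) (Fin.cons i I) (Fin.cons u U) *
        tensorPow X (r + 1) (Fin.cons u U) (Fin.cons j J) =
        tensorPowRev Y r I U * (Y i u * X u j) * tensorPow X r U J := fun u => by
      rw [tensorPow_cons, tensorPowRev_cons]; simp only [mul_assoc]
    simp_rw [this]
    rw [← Finset.sum_mul, ← Finset.mul_sum, ← Matrix.mul_apply, h, Matrix.one_apply]
    split_ifs <;> simp

/-- `L` commutes with the operator `R` on the tensor square: `R L_1 L_2 = L_1 L_2 R`. -/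
def Intertwines (R : Matrix (α × α) (α × α) K) (L : Matrix α α B) : Prop :=
  ∀ k₁ k₂ q₁ q₂, ∑ u₁, ∑ u₂, R (k₁, k₂) (u₁, u₂) • (L u₁ q₁ * L u₂ q₂) =
    ∑ u₁, ∑ u₂, R (u₁, u₂) (q₁, q₂) • (L k₁ u₁ * L k₂ u₂)

theorem opAt_cons_succ (R : Matrix (α × α) (α × α) K) (r i : ℕ) (j k : α) (J I : Fin r → α) :
    opAt R (r + 1) (i + 1) (Fin.cons j J) (Fin.cons k I) =
      (1 : Matrix α α K) j k * opAt R r i J I := by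
  unfold opAt
  by_cases h : i + 1 < r
  · rw [dif_pos h, dif_pos (by omega)]
    have e1 : (⟨i + 1, by omega⟩ : Fin (r + 1)) = Fin.succ ⟨i, by omega⟩ := rfl
    have e2 : (⟨i + 1 + 1, by omega⟩ : Fin (r + 1)) = Fin.succ ⟨i + 1, h⟩ := rfl
    rw [e1, e2]
    simp only [Fin.cons_succ, Fin.forall_fin_succ, Fin.cons_zero, Fin.val_zero, Fin.val_succ,
      Matrix.one_apply]
    by_cases hjk : j = k
    · simp [hjk]
    · simp [hjk]
  · rw [dif_neg h, dif_neg (by omega), mul_zero]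

theorem opAt_cons_zero (R : Matrix (α × α) (α × α) K) (r : ℕ) (j j' k k' : α) (J I : Fin r → α) :
    opAt R (r + 2) 0 (Fin.cons j (Fin.cons j' J)) (Fin.cons k (Fin.cons k' I)) =
      R (j, j') (k, k') * (1 : Matrix (Fin r → α) (Fin r → α) K) J I := by
  unfold opAt
  rw [dif_pos (by omega)]
  have e1 : (⟨0, by omega⟩ : Fin (r + 2)) = 0 := rfl
  have e2 : (⟨0 + 1, by omega⟩ : Fin (r + 2)) = Fin.succ 0 := rfl
  rw [e1, e2]
  simp only [Fin.cons_succ, Fin.forall_fin_succ, Fin.cons_zero, Fin.val_zero, Fin.val_succ,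
    Matrix.one_apply, funext_iff]
  simp

theorem sum_opAt_tensorPow {R : Matrix (α × α) (α × α) K} {L : Matrix α α B}
    (h : Intertwines R L) : ∀ (r i : ℕ) (I J : Fin r → α),
    ∑ U, opAt R r i I U • tensorPow L r U J = ∑ U, opAt R r i U J • tensorPow L r I U
  -- With fewer than two factors no slot exists and `opAt` is zero by default.
  | 0, i, I, J => by simp [opAt]
  | 1, i, I, J => by simp [opAt]
  | r + 2, 0, I, J => by
    induction I using Fin.consCases
    induction J using Fin.consCases
    rename_i k₁ I q₁ J
    induction I using Fin.consCases
    induction J using Fin.consCases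
    rename_i k₂ I q₂ J
    rw [sum_fin_succ_arrow, sum_fin_succ_arrow]
    simp_rw [sum_fin_succ_arrow, opAt_cons_zero, tensorPow_cons, Matrix.one_apply]
    simp only [mul_ite, mul_one, mul_zero, ite_smul, zero_smul, Finset.sum_ite_eq,
      Finset.sum_ite_eq', Finset.mem_univ, if_true, ← mul_assoc]
    have h' := congrArg (· * tensorPow L r I J) (h k₁ k₂ q₁ q₂)
    simpa only [Finset.sum_mul, smul_mul_assoc] using h'
  | r + 2, i + 1, I, J => by
    induction I using Fin.consCases
    induction J using Fin.consCases
    rename_i k₁ I q₁ J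
    rw [sum_fin_succ_arrow, sum_fin_succ_arrow]
    simp only [opAt_cons_succ, tensorPow_cons, ← smul_smul, ← mul_smul_comm, ← Finset.mul_sum,
      ← Finset.smul_sum]
    rw [sum_opAt_tensorPow h (r + 1) i I J]
    simp [Matrix.one_apply]

theorem opAt_commute_tensorPow {R : Matrix (α × α) (α × α) K} {L : Matrix α α B}
    (h : Intertwines R L) (r i : ℕ) :
    Commute ((opAt R r i).map (algebraMap K B)) (tensorPow L r) := by
  ext I J
  simp only [Matrix.mul_apply, Matrix.map_apply, ← Algebra.smul_def, ← Algebra.commutes]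
  exact sum_opAt_tensorPow h r i I J

/-- The scalar matrices that commute with the matrix `X`. -/
def scalarCentralizer (K : Type*) [Field K] {B : Type*} [Ring B] [Algebra K B]
    {γ : Type*} [Fintype γ] [DecidableEq γ] (X : Matrix γ γ B) : Subalgebra K (Matrix γ γ K) :=
  (Subalgebra.centralizer K {X}).comap (Algebra.ofId K B).mapMatrix

theorem mem_scalarCentralizer {γ : Type*} [Fintype γ] [DecidableEq γ] {X : Matrix γ γ B}
    {Φ : Matrix γ γ K} :
    Φ ∈ scalarCentralizer K X ↔ Commute (Φ.map (algebraMap K B)) X := by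
  simp only [scalarCentralizer, Subalgebra.mem_comap, Subalgebra.mem_centralizer_iff,
    Set.mem_singleton_iff, forall_eq]
  exact ⟨fun h => h.symm, fun h => h.symm⟩

/-- The Hecke sums are polynomials in the `opAt R r i`, so commutation with a tensor power need only
be checked for these generators. -/
theorem heckeSum_mem {r : ℕ} (S : Subalgebra K (Matrix (Fin r → α) (Fin r → α) K))
    {R : Matrix (α × α) (α × α) K} (h : ∀ i, opAt R r i ∈ S) (c : K) : heckeSum R c r ∈ S := by
  have hd : ∀ k i, descending R r k i ∈ S := by
    intro k i
    induction i with
    | zero => exact S.one_mem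
    | succ i ih => exact S.mul_mem ih (h _)
  refine Subalgebra.list_prod_mem S fun x hx => ?_
  obtain ⟨k, -, rfl⟩ := List.mem_map.1 hx
  exact S.sum_mem fun i _ => S.smul_mem (hd _ _) _

end TensorPowers

/-! ### The quantum trace weight obtained from a skew inverse. -/

section Weights

variable {K : Type*} [Field K] {B : Type*} [Ring B] [Algebra K B]
variable {α : Type*} [Fintype α] [DecidableEq α]

/-- `F` satisfies `∑ F^i_j L'^j_l L^p_i = F^p_l`; for `L'` the inverse of `L` this says that
conjugation by `F` implements the square of the antipode. -/
def IsTraceWeight (L L' : Matrix α α B) (F : Matrix α α K) : Prop :=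
  ∀ p l, ∑ i, ∑ j, F i j • (L' j l * L p i) = F p l • (1 : B)

/-- The quantum trace weight `S_{li}^{lj}` of the skew inverse `S` of `R`. -/
theorem isTraceWeight_of_intertwines {R S : Matrix (α × α) (α × α) K} {L L' : Matrix α α B}
    (hRS : IsSkewInverse R S) (hL : L * L' = 1) (hL' : L' * L = 1) (h : Intertwines R L) :
    IsTraceWeight L L' (fun j i => ∑ l, S (l, j) (l, i)) := by
  have mulApply : ∀ i j, ∑ u, L i u * L' u j = if i = j then 1 else 0 := fun i j => by
    rw [← Matrix.mul_apply, hL, Matrix.one_apply]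
  have mulApply' : ∀ i j, ∑ u, L' i u * L u j = if i = j then 1 else 0 := fun i j => by
    rw [← Matrix.mul_apply, hL', Matrix.one_apply]
  -- This is `R L_1 L_2 = L_1 L_2 R` multiplied by one `L'` on the left and one on the right: each
  -- side keeps one `L` and one `L'`, in opposite orders.
  have key : ∀ x y i p, ∑ a, ∑ b, R (a, p) (b, y) • (L' x a * L b i) =
      ∑ a, ∑ b, R (x, a) (i, b) • (L p a * L' b y) := by
    intro x y i p
    have e : ∀ k q, ∑ u₁, ∑ u₂, R (k, p) (u₁, u₂) • (L' x k * (L u₁ i * L u₂ q) * L' q y) =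
      ∑ u₁, ∑ u₂, R (u₁, u₂) (i, q) • (L' x k * (L k u₁ * L p u₂) * L' q y) := fun k q => by
      have := congrArg (fun z => L' x k * z * L' q y) (h k p i q)
      simpa only [Finset.mul_sum, Finset.sum_mul, mul_smul_comm, smul_mul_assoc] using this
    have e2 : ∑ k, ∑ q, ∑ u₁, ∑ u₂, R (k, p) (u₁, u₂) • (L' x k * (L u₁ i * L u₂ q) * L' q y) =
      ∑ k, ∑ q, ∑ u₁, ∑ u₂, R (u₁, u₂) (i, q) • (L' x k * (L k u₁ * L p u₂) * L' q y) :=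
      Finset.sum_congr rfl fun k _ => Finset.sum_congr rfl fun q _ => e k q
    have l1 : ∀ k, ∑ q, ∑ u₁, ∑ u₂,
        R (k, p) (u₁, u₂) • (L' x k * (L u₁ i * L u₂ q) * L' q y) =
        ∑ b, R (k, p) (b, y) • (L' x k * L b i) := fun k => by
      rw [Finset.sum_comm]
      refine Finset.sum_congr rfl fun b _ => ?_
      rw [Finset.sum_comm]
      simp only [← Finset.smul_sum, mul_assoc, ← Finset.mul_sum, mulApply]
      simp
    have l2 : ∀ q, ∑ k, ∑ u₁, ∑ u₂,
        R (u₁, u₂) (i, q) • (L' x k * (L k u₁ * L p u₂) * L' q y) =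
        ∑ a, R (x, a) (i, q) • (L p a * L' q y) := fun q => by
      rw [Finset.sum_comm]
      simp_rw [Finset.sum_comm (s := (Finset.univ : Finset α)) (t := (Finset.univ : Finset α))
        (f := fun k u₂ => R (_, u₂) (i, q) • (L' x k * (L k _ * L p u₂) * L' q y))]
      simp only [← Finset.smul_sum, ← mul_assoc, ← Finset.sum_mul, mulApply']
      simp
    rw [Finset.sum_congr rfl fun k _ => l1 k] at e2
    rw [e2, Finset.sum_comm, Finset.sum_congr rfl fun q _ => l2 q, Finset.sum_comm]
  have hS : ∀ a b k l, ∑ y, ∑ p, S (y, k) (p, l) * R (a, p) (b, y) =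
      (if b = k then 1 else 0) * (if a = l then 1 else 0) := fun a b k l => by
    rw [← hRS.1 b k a l]
    exact Finset.sum_congr rfl fun _ _ => Finset.sum_congr rfl fun _ _ => mul_comm _ _
  have hS' : ∀ a b, ∑ i, ∑ x, (∑ e, S (e, i) (e, x)) * R (x, a) (i, b) =
      if a = b then 1 else 0 := fun a b => by
    have : ∀ e, ∑ i, ∑ x, S (e, i) (e, x) * R (x, a) (i, b) =
        (if e = a then 1 else 0) * (if e = b then 1 else 0) := fun e => by
      rw [Finset.sum_comm, hRS.2 e a e b]
    simp only [Finset.sum_mul]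
    rw [Finset.sum_congr rfl fun i _ => Finset.sum_comm, Finset.sum_comm,
      Finset.sum_congr rfl fun e _ => this e]
    simp [eq_comm]
  have swap' : ∀ (f : α → α → K) (g : α → α → α → α → K) (N : α → α → B),
      ∑ i, ∑ x, f i x • ∑ a, ∑ b, g i x a b • N a b =
      ∑ a, ∑ b, (∑ i, ∑ x, f i x * g i x a b) • N a b := fun f g N => by
    simp only [Finset.smul_sum, Finset.sum_smul, smul_smul]
    rw [Finset.sum_congr rfl fun i _ => Finset.sum_comm, Finset.sum_comm]
    refine Finset.sum_congr rfl fun y _ => ?_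
    rw [Finset.sum_congr rfl fun i _ => Finset.sum_comm, Finset.sum_comm]
  have swap : ∀ (f g : α → α → K) (N : α → α → α → α → B),
      ∑ i, ∑ x, f i x • ∑ y, ∑ p, g y p • N i x y p =
      ∑ y, ∑ p, ∑ i, ∑ x, (f i x * g y p) • N i x y p := fun f g N => by
    simp only [Finset.smul_sum, smul_smul]
    rw [Finset.sum_congr rfl fun i _ => Finset.sum_comm, Finset.sum_comm]
    refine Finset.sum_congr rfl fun y _ => ?_
    rw [Finset.sum_congr rfl fun i _ => Finset.sum_comm, Finset.sum_comm]
  have left : ∀ k l x i, ∑ y, ∑ p, S (y, k) (p, l) •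
      (∑ a, ∑ b, R (a, p) (b, y) • (L' x a * L b i)) = L' x l * L k i := fun k l x i => by
    refine (swap' (fun y p => S (y, k) (p, l)) (fun y p a b => R (a, p) (b, y)) _).trans ?_
    simp [hS]
  have right : ∀ y p, ∑ i, ∑ x, (∑ e, S (e, i) (e, x)) •
      (∑ a, ∑ b, R (x, a) (i, b) • (L p a * L' b y)) = if p = y then 1 else 0 := fun y p => by
    refine (swap' (fun i x => ∑ e, S (e, i) (e, x)) (fun i x a b => R (x, a) (i, b)) _).trans ?_
    simp [hS', mulApply]
  intro p l
  -- Both sides of `key` are contracted with `S` and with the weight. On the left `S` cancels `R`,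
  -- leaving `L' L` under the weight. On the right the weight cancels `R`, then `L L' = 1`, and the
  -- remaining contraction of `S` is the weight itself.
  have e : ∑ i, ∑ x, (∑ e, S (e, i) (e, x)) • (∑ y, ∑ p', S (y, p) (p', l) •
      (∑ a, ∑ b, R (a, p') (b, y) • (L' x a * L b i))) =
      ∑ y, ∑ p', S (y, p) (p', l) • (∑ i, ∑ x, (∑ e, S (e, i) (e, x)) •
      (∑ a, ∑ b, R (x, a) (i, b) • (L p' a * L' b y))) := by
    have sw := swap (fun i x => ∑ e, S (e, i) (e, x)) (fun y p' => S (y, p) (p', l))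
      (fun i x y p' => ∑ a, ∑ b, R (x, a) (i, b) • (L p' a * L' b y))
    simp only [key]
    rw [sw]
    simp only [Finset.smul_sum (s := (Finset.univ : Finset α)) (r := S _ _), smul_smul]
    refine Finset.sum_congr rfl fun y _ => Finset.sum_congr rfl fun p' _ => ?_
    exact Finset.sum_congr rfl fun i _ => Finset.sum_congr rfl fun x _ => by rw [mul_comm]
  simp only [left, right] at e
  rw [e]
  simp [Finset.sum_smul]

end Weights

/-! ### Commuting quantum traces from an exchange relation. -/

section TraceSystems

variable {K : Type*} [Field K] {H : Type*} [Ring H] [Algebra K H]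
variable {α β : Type*} [Fintype α] [DecidableEq α] [Fintype β] [DecidableEq β]

/-- Exchange of the two tensor factors in a matrix with matrix entries. -/
def flip (L : Matrix α α (Matrix β β K)) : Matrix β β (Matrix α α K) :=
  fun k q p i => L p i k q

theorem flip_mul_flip {L L' : Matrix α α (Matrix β β K)} (h : L * L' = 1) :
    flip L * flip L' = 1 := by
  ext k q p i
  have := congrFun (congrFun (congrFun (congrFun h p) i) k) q
  simp only [Matrix.mul_apply, Matrix.sum_apply, Matrix.one_apply, flip] at this ⊢
  rw [Finset.sum_comm, this]
  split_ifs <;> simp_all [Matrix.one_apply]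

variable (H) in
/-- Entrywise inclusion of the scalar matrices. -/
def scalarEntries : Matrix β β K →+* Matrix β β H := (algebraMap K H).mapMatrix

theorem scalarEntries_apply (M : Matrix β β K) (i j : β) :
    scalarEntries H M i j = algebraMap K H (M i j) := rfl

theorem commute_scalarEntries_scalar (M : Matrix β β K) (a : H) :
    Commute (scalarEntries H M) (Matrix.scalar β a) := by
  ext i j
  simp [scalarEntries_apply, Matrix.scalar_apply, Algebra.commutes]

/-- Matrices `A`, `V` over `H` that satisfy the exchange relation `V L A = A L V` with an invertible
operator `L`, together with weights `F`, `G` of the corresponding quantum traces. -/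
structure TraceSystem (L L' : Matrix α α (Matrix β β K)) (F : Matrix α α K) (G : Matrix β β K)
    (A : Matrix α α H) (V : Matrix β β H) : Prop where
  mul_eq_one : L * L' = 1
  mul_eq_one' : L' * L = 1
  left_weight : IsTraceWeight L L' F
  right_weight : ∀ i q, ∑ l, L l q * G * L' i l = (1 : Matrix α α K) i q • G
  exchange : ∀ l i, SemiconjBy V ((L.map (scalarEntries H) * A.map (Matrix.scalar β)) l i)
    ((A.map (Matrix.scalar β) * L.map (scalarEntries H)) l i)

namespace TraceSystem

variable {L L' : Matrix α α (Matrix β β K)} {F : Matrix α α K} {G : Matrix β β K}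
  {A : Matrix α α H} {V : Matrix β β H}

/-- Both forms are the same double sum in entries. The matrix form fits under a trace over `β`; the
other brings `G` under the theory of `IsTraceWeight`. -/
theorem right_weight_iff : (∀ i q, ∑ l, L l q * G * L' i l = (1 : Matrix α α K) i q • G) ↔
    IsTraceWeight (flip L) (flip L') G := by
  have e : ∀ i q p k, (∑ l, L l q * G * L' i l) p k =
      (∑ x, ∑ j, G x j • (flip L' j k * flip L p x)) i q := fun i q p k => by
    simp only [Matrix.sum_apply, Matrix.mul_apply, Matrix.smul_apply, flip, smul_eq_mul,
      Finset.sum_mul, Finset.mul_sum]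
    rw [Finset.sum_comm, Finset.sum_congr rfl fun j _ => Finset.sum_comm, Finset.sum_comm]
    refine Finset.sum_congr rfl fun x _ => Finset.sum_congr rfl fun j _ =>
      Finset.sum_congr rfl fun l _ => by ring
  constructor
  · intro h p k
    ext i q
    rw [← e, h]
    simp [mul_comm]
  · intro h i q
    ext p k
    rw [e, h]
    simp [mul_comm]

theorem exchange_iff : (∀ l i, SemiconjBy V
      ((L.map (scalarEntries H) * A.map (Matrix.scalar β)) l i)
      ((A.map (Matrix.scalar β) * L.map (scalarEntries H)) l i)) ↔
    ∀ l i k j, ∑ p, ∑ q, L l q p j • (V k p * A q i) = ∑ p, ∑ q, L p i k q • (A l p * V q j) := by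
  have e1 : ∀ l i k j, (V * (L.map (scalarEntries H) * A.map (Matrix.scalar β)) l i) k j =
      ∑ p, ∑ q, L l q p j • (V k p * A q i) := fun l i k j => by
    simp [Matrix.mul_apply, Matrix.sum_apply, scalarEntries_apply, Finset.mul_sum,
      Algebra.smul_def, Algebra.left_comm, Matrix.diagonal_apply]
  have e2 : ∀ l i k j, ((A.map (Matrix.scalar β) * L.map (scalarEntries H)) l i * V) k j =
      ∑ p, ∑ q, L p i k q • (A l p * V q j) := fun l i k j => by
    simp [Matrix.mul_apply, Matrix.sum_apply, scalarEntries_apply, Finset.sum_mul,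
      Algebra.smul_def, ← mul_assoc, Algebra.commutes, Matrix.diagonal_apply]
    rw [Finset.sum_comm]
  constructor
  · intro h l i k j
    rw [← e1, ← e2, (h l i).eq]
  · intro h l i
    ext k j
    rw [e1, e2, h]

/-- The structure is symmetric: the two weight conditions change places and the exchange relation is
read backwards. Results on powers of `A` therefore apply to `V`. -/
protected theorem flip (h : TraceSystem L L' F G A V) :
    TraceSystem (flip L) (flip L') G F V A where
  mul_eq_one := flip_mul_flip h.mul_eq_one
  mul_eq_one' := flip_mul_flip h.mul_eq_one'
  left_weight := right_weight_iff.1 h.right_weight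
  right_weight := right_weight_iff.2 h.left_weight
  exchange := exchange_iff.2 fun k j l i => (exchange_iff.1 h.exchange l i k j).symm

theorem trace_scalarEntries_mul_comm (M : Matrix β β K) (X : Matrix β β H) :
    (scalarEntries H M * X).trace = (X * scalarEntries H M).trace := by
  simp only [Matrix.trace, Matrix.diag_apply, Matrix.mul_apply, scalarEntries_apply]
  rw [Finset.sum_comm]
  simp only [Algebra.commutes]

theorem trace_scalar_mul (a : H) (X : Matrix β β H) :
    (Matrix.scalar β a * X).trace = a * X.trace := by
  simp [Matrix.trace, Finset.mul_sum]

theorem trace_mul_scalar (a : H) (X : Matrix β β H) :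
    (X * Matrix.scalar β a).trace = X.trace * a := by
  simp [Matrix.trace, Finset.sum_mul]

/-- The quantum traces of the two matrices of a trace system commute. -/
theorem commute_trace (h : TraceSystem L L' F G A V) :
    Commute (∑ i, ∑ q, F i q • A q i) (∑ p, ∑ k, G p k • V k p) := by
  have hV : ∑ p, ∑ k, G p k • V k p = (V * scalarEntries H G).trace := by
    simp only [Matrix.trace, Matrix.diag_apply, Matrix.mul_apply, scalarEntries_apply,
      ← Algebra.commutes, Algebra.smul_def]
    rw [Finset.sum_comm]
  -- The entries of `A` commute with scalar matrices, so `L'` and `L` become adjacent and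
  -- `left_weight` absorbs them.
  have e1 : ∀ l, ∑ i, ∑ j, F i j • (scalarEntries H (L' j l) *
      ((A.map (Matrix.scalar β) * L.map (scalarEntries H)) l i)) =
      ∑ p, F p l • Matrix.scalar β (A l p) := fun l => by
    have : ∀ p, ∑ i, ∑ j, F i j • (scalarEntries H (L' j l) * (Matrix.scalar β (A l p) *
        scalarEntries H (L p i))) = F p l • Matrix.scalar β (A l p) := fun p => by
      have h1 := congrArg (scalarEntries H) (h.left_weight p l)
      have h2 : ∀ (c : K) (M : Matrix β β K),
          scalarEntries H (c • M) = c • scalarEntries H M := fun c M => by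
        ext; simp only [scalarEntries_apply, Matrix.smul_apply, smul_eq_mul, map_mul,
            Algebra.smul_def (A := H)]
      simp only [map_sum, h2, map_mul, map_one] at h1
      calc _ = Matrix.scalar β (A l p) * ∑ i, ∑ j,
              F i j • (scalarEntries H (L' j l) * scalarEntries H (L p i)) := by
            simp only [Finset.mul_sum, mul_smul_comm, ← mul_assoc,
              (commute_scalarEntries_scalar _ _).eq]
        _ = _ := by rw [h1, mul_smul_comm, mul_one]
    simp only [← this, Matrix.mul_apply, Matrix.map_apply, Finset.mul_sum, Finset.smul_sum]
    rw [Finset.sum_congr rfl fun i _ => Finset.sum_comm, Finset.sum_comm]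
  -- Entries in `H` do not commute, so only scalar matrices may be cycled under the trace. Moving
  -- `L'` to the end produces `L G L'`, to which `right_weight` applies.
  have e2 : ∀ i j, ∑ l, (scalarEntries H (L' j l) * (V *
      (L.map (scalarEntries H) * A.map (Matrix.scalar β)) l i) * scalarEntries H G).trace =
      (V * scalarEntries H G).trace * A j i := fun i j => by
    have : ∀ l q, (scalarEntries H (L' j l) * (V *
        (scalarEntries H (L l q) * Matrix.scalar β (A q i))) * scalarEntries H G).trace =
        (V * scalarEntries H (L l q * G * L' j l)).trace * A q i := fun l q => by
      rw [← trace_mul_scalar, mul_assoc, trace_scalarEntries_mul_comm]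
      simp only [map_mul, mul_assoc]
      rw [← mul_assoc (Matrix.scalar β (A q i)), ← (commute_scalarEntries_scalar G (A q i)).eq,
        mul_assoc, ← (commute_scalarEntries_scalar (L' j l) (A q i)).eq]
    have w : ∀ q, ∑ l, (V * scalarEntries H (L l q * G * L' j l)).trace * A q i =
        (1 : Matrix α α K) j q • ((V * scalarEntries H G).trace * A q i) := fun q => by
      rw [← Finset.sum_mul, ← Matrix.trace_sum, ← Finset.mul_sum, ← map_sum, h.right_weight,
        Matrix.one_apply]
      split_ifs <;> simp
    have : ∀ l, (scalarEntries H (L' j l) * (V *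
        (L.map (scalarEntries H) * A.map (Matrix.scalar β)) l i) * scalarEntries H G).trace =
        ∑ q, (V * scalarEntries H (L l q * G * L' j l)).trace * A q i := fun l => by
      simp only [← this, Matrix.mul_apply, Matrix.map_apply, Finset.mul_sum, Finset.sum_mul,
        Matrix.trace_sum]
    simp only [this]
    rw [Finset.sum_comm, Finset.sum_congr rfl fun q _ => w q]
    simp [Matrix.one_apply]
  have e3 : Matrix.scalar β (∑ i, ∑ q, F i q • A q i) =
      ∑ l, ∑ i, ∑ j, F i j • (scalarEntries H (L' j l) *
        ((A.map (Matrix.scalar β) * L.map (scalarEntries H)) l i)) := by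
    rw [Finset.sum_congr rfl fun l _ => e1 l, Finset.sum_comm]
    simp only [map_sum]
    refine Finset.sum_congr rfl fun i _ => Finset.sum_congr rfl fun q _ => ?_
    ext k l
    simp [Matrix.diagonal_apply]
  rw [hV]
  change _ * _ = _ * _
  rw [← trace_scalar_mul, e3]
  simp only [Finset.sum_mul, Matrix.trace_sum, smul_mul_assoc, Matrix.trace_smul, mul_assoc,
    Finset.mul_sum, mul_smul_comm]
  rw [Finset.sum_comm]
  refine Finset.sum_congr rfl fun i _ => ?_
  rw [Finset.sum_comm]
  refine Finset.sum_congr rfl fun j _ => ?_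
  rw [← Finset.smul_sum, ← e2]
  congr 1
  refine Finset.sum_congr rfl fun l _ => ?_
  rw [(h.exchange l i).eq]
  simp only [mul_assoc]

end TraceSystem
end TraceSystems

/-! ### Passage of weights and exchange relations to tensor powers. -/

section TensorSteps

variable {K : Type*} [Field K] {B : Type*} [Ring B] [Algebra K B]
variable {α : Type*} [Fintype α] [DecidableEq α]

/-- The tensor power of a scalar matrix. -/
def scalarPow (F : Matrix α α K) (r : ℕ) : Matrix (Fin r → α) (Fin r → α) K :=
  fun I J => ∏ a, F (I a) (J a)

theorem scalarPow_cons (F : Matrix α α K) {r : ℕ} (i j : α) (I J : Fin r → α) :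
    scalarPow F (r + 1) (Fin.cons i I) (Fin.cons j J) = F i j * scalarPow F r I J := by
  simp [scalarPow, Fin.prod_univ_succ]

/-- In `L'_r ⋯ L'_1 L_1 ⋯ L_r` the factors of the first position meet in the middle and collapse to
a scalar, which can be pulled out. -/
theorem IsTraceWeight.tensorPow {L L' : Matrix α α B} {F : Matrix α α K}
    (h : IsTraceWeight L L' F) (r : ℕ) :
    IsTraceWeight (tensorPow L r) (tensorPowRev L' r) (scalarPow F r) := by
  induction r with
  | zero =>
    intro P Q
    simp [scalarPow]
  | succ r ih =>
    intro P Q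
    induction P using Fin.consCases
    induction Q using Fin.consCases
    rename_i p P q Q
    rw [sum_fin_succ_arrow, Finset.sum_comm]
    have : ∀ I : Fin r → α, ∑ i, ∑ J, scalarPow F (r + 1) (Fin.cons i I) J •
        (tensorPowRev L' (r + 1) J (Fin.cons q Q) *
          QuantumBer.tensorPow L (r + 1) (Fin.cons p P) (Fin.cons i I)) =
        F p q • ∑ J, scalarPow F r I J •
          (tensorPowRev L' r J Q * QuantumBer.tensorPow L r P I) := fun I => by
      simp only [sum_fin_succ_arrow, tensorPow_cons, tensorPowRev_cons, scalarPow_cons]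
      rw [Finset.sum_congr rfl fun i _ => Finset.sum_comm, Finset.sum_comm, Finset.smul_sum]
      refine Finset.sum_congr rfl fun J _ => ?_
      have e : ∀ i j, (F i j * scalarPow F r I J) •
          (tensorPowRev L' r J Q * L' j q * (L p i * QuantumBer.tensorPow L r P I)) =
          scalarPow F r I J • (tensorPowRev L' r J Q * (F i j • (L' j q * L p i)) *
            QuantumBer.tensorPow L r P I) := fun i j => by
        simp only [mul_assoc, mul_smul_comm, smul_mul_assoc, smul_smul, mul_comm]
      simp only [e, ← Finset.smul_sum, ← Finset.sum_mul, ← Finset.mul_sum, h p q]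
      rw [mul_smul_comm, mul_one, smul_mul_assoc, smul_comm]
    simp only [this]
    rw [← Finset.smul_sum, ih, scalarPow_cons, smul_smul]

/-- A matrix commuting with `L` commutes with `L'`, so `Φ` can be pushed through `L'` to the free
lower index. -/
theorem IsTraceWeight.mul_of_commute {L L' : Matrix α α B} {F Φ : Matrix α α K}
    (h : IsTraceWeight L L' F) (hL : L * L' = 1) (hL' : L' * L = 1)
    (hΦ : Commute (Φ.map (algebraMap K B)) L) : IsTraceWeight L L' (F * Φ) := by
  have hΦ' : Φ.map (algebraMap K B) * L' = L' * Φ.map (algebraMap K B) := by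
    calc _ = L' * L * (Φ.map (algebraMap K B) * L') := by rw [hL', one_mul]
      _ = L' * (Φ.map (algebraMap K B) * L) * L' := by rw [hΦ.eq]; simp only [mul_assoc]
      _ = _ := by simp only [mul_assoc, hL, mul_one]
  intro p l
  have e : ∀ u, ∑ j, Φ u j • L' j l = ∑ j, Φ j l • L' u j := fun u => by
    have := congrFun (congrFun hΦ' u) l
    simpa only [Matrix.mul_apply, Matrix.map_apply, ← Algebra.commutes,
      ← Algebra.smul_def] using this
  calc ∑ i, ∑ j, (F * Φ) i j • (L' j l * L p i)
      = ∑ i, ∑ u, F i u • ((∑ j, Φ u j • L' j l) * L p i) := by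
        simp only [Matrix.mul_apply, Finset.sum_smul, Finset.sum_mul, Finset.smul_sum,
          smul_mul_assoc, smul_smul]
        exact Finset.sum_congr rfl fun i _ => Finset.sum_comm
    _ = ∑ j, Φ j l • ∑ i, ∑ u, F i u • (L' u j * L p i) := by
        simp only [e, Finset.sum_mul, Finset.smul_sum, smul_mul_assoc]
        rw [Finset.sum_congr rfl fun i _ => Finset.sum_comm, Finset.sum_comm]
        simp only [smul_smul, mul_comm]
    _ = _ := by
        simp only [h p, smul_smul, Matrix.mul_apply, Finset.sum_smul, mul_comm]

variable {β : Type*} [Fintype β] [DecidableEq β]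

theorem right_weight_tensorPow {L L' : Matrix α α B} {G : B}
    (h : ∀ i q, ∑ l, L l q * G * L' i l = (1 : Matrix α α K) i q • G) (r : ℕ) (I Q : Fin r → α) :
    ∑ U, tensorPow L r U Q * G * tensorPowRev L' r I U =
      (1 : Matrix (Fin r → α) (Fin r → α) K) I Q • G := by
  induction r with
  | zero => simp [Matrix.one_apply, Subsingleton.elim I Q]
  | succ r ih =>
    induction I using Fin.consCases
    induction Q using Fin.consCases
    rename_i i I q Q
    simp only [sum_fin_succ_arrow, tensorPow_cons, tensorPowRev_cons]
    have e : ∀ u U, L u q * tensorPow L r U Q * G * (tensorPowRev L' r I U * L' i u) =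
        L u q * (tensorPow L r U Q * G * tensorPowRev L' r I U) * L' i u := fun u U => by
      simp only [mul_assoc]
    simp only [e, ← Finset.mul_sum, ← Finset.sum_mul, ih, mul_smul_comm, smul_mul_assoc,
      ← Finset.smul_sum, h, one_apply_cons, smul_smul]
    rw [mul_comm]

/-- The matrices `∑_u L^u_i ⊗ L^p_u` in terms of which `Intertwines R (flip L)` is a commutation
relation. -/
theorem intertwines_flip_iff {R : Matrix (β × β) (β × β) K} {L : Matrix α α (Matrix β β K)} :
    Intertwines R (flip L) ↔ ∀ p i, Commute R
      ((L.map (fun M => M ⊗ₖ (1 : Matrix β β K)) *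
        L.map (fun M => (1 : Matrix β β K) ⊗ₖ M)) p i) := by
  have e : ∀ p i k₁ k₂ q₁ q₂, (L.map (fun M => M ⊗ₖ (1 : Matrix β β K)) *
        L.map (fun M => (1 : Matrix β β K) ⊗ₖ M)) p i (k₁, k₂) (q₁, q₂) =
      (flip L k₁ q₁ * flip L k₂ q₂) p i := fun p i k₁ k₂ q₁ q₂ => by
    simp [Matrix.mul_apply, Matrix.sum_apply, ← Matrix.mul_kronecker_mul, flip]
  have comm : ∀ D : Matrix (β × β) (β × β) K, Commute R D ↔ ∀ k₁ k₂ q₁ q₂,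
      ∑ u₁, ∑ u₂, R (k₁, k₂) (u₁, u₂) * D (u₁, u₂) (q₁, q₂) =
      ∑ u₁, ∑ u₂, R (u₁, u₂) (q₁, q₂) * D (k₁, k₂) (u₁, u₂) := fun D => by
    simp only [commute_iff_eq, ← Matrix.ext_iff, Prod.forall, Matrix.mul_apply,
      Fintype.sum_prod_type, mul_comm (D _ _)]
  simp only [comm, e]
  constructor
  · intro h p i k₁ k₂ q₁ q₂
    have := congrFun (congrFun (h k₁ k₂ q₁ q₂) p) i
    simpa only [Matrix.sum_apply, Matrix.smul_apply, smul_eq_mul] using this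
  · intro h k₁ k₂ q₁ q₂
    ext p i
    simpa only [Matrix.sum_apply, Matrix.smul_apply, smul_eq_mul] using h p i k₁ k₂ q₁ q₂

/-- The condition says that `R` commutes with every entry of a matrix over `End(V_1 ⊗ V_1)`. The two
embeddings of `End V_1` commute, so the matrix for the tensor power has products of such entries as
its entries. -/
theorem Intertwines.flip_tensorPow {R : Matrix (β × β) (β × β) K} {L : Matrix α α (Matrix β β K)}
    (h : Intertwines R (flip L)) (r : ℕ) : Intertwines R (flip (tensorPow L r)) := by
  rw [intertwines_flip_iff] at h ⊢
  let f : Matrix β β K →+* Matrix (β × β) (β × β) K :=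
    { toFun := fun M => M ⊗ₖ (1 : Matrix β β K)
      map_one' := Matrix.one_kronecker_one
      map_mul' := fun M N => by rw [← Matrix.mul_kronecker_mul, one_mul]
      map_zero' := Matrix.zero_kronecker _
      map_add' := fun M N => Matrix.add_kronecker _ _ _ }
  let g : Matrix β β K →+* Matrix (β × β) (β × β) K :=
    { toFun := fun M => (1 : Matrix β β K) ⊗ₖ M
      map_one' := Matrix.one_kronecker_one
      map_mul' := fun M N => by rw [← Matrix.mul_kronecker_mul, one_mul]
      map_zero' := Matrix.kronecker_zero _
      map_add' := fun M N => Matrix.kronecker_add _ _ _ }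
  have hfg : ∀ M N, Commute (f M) (g N) := fun M N => by
    change (_ ⊗ₖ _) * (_ ⊗ₖ _) = (_ ⊗ₖ _) * (_ ⊗ₖ _)
    rw [← Matrix.mul_kronecker_mul, ← Matrix.mul_kronecker_mul]
    simp
  intro P I
  have e : (tensorPow L r).map (fun M => M ⊗ₖ (1 : Matrix β β K)) *
        (tensorPow L r).map (fun M => (1 : Matrix β β K) ⊗ₖ M) =
      tensorPow (L.map f * L.map g) r := by
    rw [tensorPow_mul (X := L.map f) (Y := L.map g) fun i j k l => hfg _ _]
    congr 1 <;> · ext1 I J; rw [tensorPow_map]; rfl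
  rw [e]
  exact commute_tensorPow h r P I

variable {H : Type*} [Ring H] [Algebra K H]

/-- Passage to the tensor powers in the first variable of a trace system. -/
theorem TraceSystem.tensorPow {L L' : Matrix α α (Matrix β β K)} {F : Matrix α α K}
    {G : Matrix β β K} {A : Matrix α α H} {V : Matrix β β H} (h : TraceSystem L L' F G A V) (r : ℕ)
    {Φ : Matrix (Fin r → α) (Fin r → α) K}
    (hΦ : Φ ∈ scalarCentralizer K (tensorPow L r)) :
    TraceSystem (tensorPow L r) (tensorPowRev L' r) (scalarPow F r * Φ) G
      (QuantumBer.tensorPow A r) V where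
  mul_eq_one := tensorPow_mul_tensorPowRev h.mul_eq_one r
  mul_eq_one' := tensorPowRev_mul_tensorPow h.mul_eq_one' r
  left_weight := (h.left_weight.tensorPow r).mul_of_commute
    (tensorPow_mul_tensorPowRev h.mul_eq_one r) (tensorPowRev_mul_tensorPow h.mul_eq_one' r)
    (mem_scalarCentralizer.1 hΦ)
  right_weight := right_weight_tensorPow h.right_weight r
  exchange := by
    have eL : (QuantumBer.tensorPow L r).map (scalarEntries H) =
        QuantumBer.tensorPow (L.map (scalarEntries H)) r := by
      ext1 I J; rw [tensorPow_map]; rfl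
    have eA : (QuantumBer.tensorPow A r).map (Matrix.scalar β) =
        QuantumBer.tensorPow (A.map (Matrix.scalar β)) r := by
      ext1 I J; rw [tensorPow_map]; rfl
    rw [eL, eA, ← tensorPow_mul fun i j k l => commute_scalarEntries_scalar _ _,
      ← tensorPow_mul fun i j k l => (commute_scalarEntries_scalar _ _).symm]
    exact semiconjBy_tensorPow h.exchange r

end TensorSteps

/-! ### The braiding `P` as a matrix of operators. -/

section BraidingEntries

variable {K : Type*} [Field K]
variable {α β : Type*} [Fintype α] [DecidableEq α] [Fintype β] [DecidableEq β]

/-- The operator `R` with both tensor squares read from right to left. -/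
def mirror (R : Matrix (α × α) (α × α) K) : Matrix (α × α) (α × α) K :=
  R.submatrix Prod.swap Prod.swap

theorem mirror_apply (R : Matrix (α × α) (α × α) K) (a b c d : α) :
    mirror R (a, b) (c, d) = R (b, a) (d, c) := rfl

theorem IsSkewInverse.mirror {R S : Matrix (α × α) (α × α) K} (h : IsSkewInverse R S) :
    IsSkewInverse (mirror R) (mirror S) := by
  constructor
  · intro i k j l
    simp only [mirror_apply]
    rw [Finset.sum_comm]
    refine Eq.trans ?_ ((h.2 l j k i).trans ?_)
    · exact Finset.sum_congr rfl fun _ _ => Finset.sum_congr rfl fun _ _ => mul_comm _ _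
    · simp only [eq_comm, mul_comm]
  · intro i k j l
    simp only [mirror_apply]
    rw [Finset.sum_comm]
    refine Eq.trans ?_ ((h.1 l j k i).trans ?_)
    · exact Finset.sum_congr rfl fun _ _ => Finset.sum_congr rfl fun _ _ => mul_comm _ _
    · simp only [eq_comm, mul_comm]

theorem isSkewInverse_skewInv {R : Matrix (α × α) (α × α) K} (h : IsClosedOp R) :
    IsSkewInverse R (skewInv R) := by
  rw [skewInv, dif_pos h]
  exact h.choose_spec

theorem traceG_eq_mirror (R : Matrix (α × α) (α × α) K) :
    traceG R = fun j i => ∑ l, mirror (skewInv R) (l, j) (l, i) := rfl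

/-- `P : V_0 ⊗ V_1 → V_1 ⊗ V_0` as a matrix on `V_0` whose entries are operators on `V_1`. -/
def braidEntries (P : Matrix (β × α) (α × β) K) : Matrix α α (Matrix β β K) :=
  fun p i k q => P (k, p) (i, q)

/-- The inverse of `P` as a matrix on `V_0` whose entries are operators on `V_1`. -/
def braidInvEntries (Q : Matrix (α × β) (β × α) K) : Matrix α α (Matrix β β K) :=
  fun i l x k => Q (i, x) (k, l)

theorem braidEntries_mul_inv {P : Matrix (β × α) (α × β) K} {Q : Matrix (α × β) (β × α) K}
    (h : P * Q = 1) : braidEntries P * braidInvEntries Q = 1 := by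
  ext p l k x
  have := congrFun (congrFun h (k, p)) (x, l)
  rw [Matrix.mul_apply, Fintype.sum_prod_type] at this
  simp only [Matrix.mul_apply, Matrix.sum_apply, braidEntries, braidInvEntries, this]
  simp only [Matrix.one_apply, Prod.mk.injEq]
  split_ifs <;> simp_all [Matrix.one_apply]

theorem braidInvEntries_mul {P : Matrix (β × α) (α × β) K} {Q : Matrix (α × β) (β × α) K}
    (h : Q * P = 1) : braidInvEntries Q * braidEntries P = 1 := by
  ext i q x j
  have := congrFun (congrFun h (i, x)) (q, j)
  rw [Matrix.mul_apply, Fintype.sum_prod_type, Finset.sum_comm] at this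
  simp only [Matrix.mul_apply, Matrix.sum_apply, braidEntries, braidInvEntries, this]
  simp only [Matrix.one_apply, Prod.mk.injEq]
  split_ifs <;> simp_all [Matrix.one_apply]

theorem onLeft_apply {α β γ δ ε : Type*} [DecidableEq ε] (M : Matrix (α × β) (γ × δ) K)
    (a : α) (b : β) (e : ε) (c : γ) (d : δ) (e' : ε) :
    onLeft ε M (a, b, e) (c, d, e') = if e = e' then M (a, b) (c, d) else 0 := by
  simp [onLeft, Matrix.one_apply]

theorem onRight_apply {α β γ δ ε : Type*} [DecidableEq ε] (M : Matrix (α × β) (γ × δ) K)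
    (a : α) (b : β) (e : ε) (c : γ) (d : δ) (e' : ε) :
    onRight ε M (e, a, b) (e', c, d) = if e = e' then M (a, b) (c, d) else 0 := by
  simp [onRight, Matrix.one_apply]

theorem intertwines_braidEntries {R : Matrix (α × α) (α × α) K} {P : Matrix (β × α) (α × β) K}
    (h : onLeft α P * onRight α P * onLeft β R = onRight β R * onLeft α P * onRight α P) :
    Intertwines R (braidEntries P) := by
  intro p₁ p₂ i₁ i₂
  ext k q
  have := congrFun (congrFun h (k, p₁, p₂)) (i₁, i₂, q)
  simp only [Matrix.mul_apply, Fintype.sum_prod_type, onLeft_apply, onRight_apply,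
    mul_ite, ite_mul, mul_zero, zero_mul, Finset.sum_ite_eq, Finset.sum_ite_eq', Finset.mem_univ,
    if_true, Finset.sum_const_zero, Finset.sum_ite_irrel] at this
  simp only [Matrix.sum_apply, Matrix.smul_apply, Matrix.mul_apply, braidEntries, smul_eq_mul]
  calc _ = ∑ u₁, ∑ u₂, (∑ x, R (p₁, p₂) (u₁, u₂) * P (k, u₁) (i₁, x) * P (x, u₂) (i₂, q)) := by
        simp only [Finset.mul_sum, mul_assoc]
    _ = ∑ x, ∑ u₂, (∑ u₁, R (p₁, p₂) (u₁, u₂) * P (k, u₁) (i₁, x)) * P (x, u₂) (i₂, q) := by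
        simp only [Finset.sum_mul]
        rw [Finset.sum_congr rfl fun c _ => Finset.sum_comm, Finset.sum_comm,
          Finset.sum_congr rfl fun c _ => Finset.sum_comm]
    _ = _ := by
        rw [← this]
        simp only [mul_comm]

/-- In `P_2 P_1` the factor `V_0` passes the first copy of `V_1` before the second, so the operators
on `V_0` compose in the order opposite to the tensor positions. Hence `mirror R`, and hence `traceG`
and `reversed` in the odd determinant. -/
theorem intertwines_flip_braidEntries {R : Matrix (β × β) (β × β) K}
    {P : Matrix (β × α) (α × β) K}
    (h : onRight β P * onLeft β P * onRight α R = onLeft α R * onRight β P * onLeft β P) :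
    Intertwines (mirror R) (flip (braidEntries P)) := by
  intro k₁ k₂ q₁ q₂
  ext p i
  have := congrFun (congrFun h (k₂, k₁, p)) (i, q₂, q₁)
  simp only [Matrix.mul_apply, Fintype.sum_prod_type, onLeft_apply, onRight_apply, 
    mul_ite, ite_mul, mul_zero, zero_mul, Finset.sum_ite_eq, Finset.sum_ite_eq', Finset.mem_univ,
    if_true, Finset.sum_const_zero, Finset.sum_ite_irrel] at this
  simp only [Matrix.sum_apply, Matrix.smul_apply, Matrix.mul_apply, flip, braidEntries, mirror_apply, smul_eq_mul]
  calc _ = ∑ c, ∑ c', ∑ x, R (k₂, k₁) (c', c) * P (c, p) (x, q₁) * P (c', x) (i, q₂) := by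
        simp only [Finset.mul_sum, mul_assoc]
    _ = ∑ c', ∑ x, (∑ c, R (k₂, k₁) (c', c) * P (c, p) (x, q₁)) * P (c', x) (i, q₂) := by
        simp only [Finset.sum_mul]
        rw [Finset.sum_comm, Finset.sum_congr rfl fun c _ => Finset.sum_comm]
    _ = _ := by
        rw [← this, Finset.sum_comm]
        simp only [mul_comm]

end BraidingEntries

/-! ### The exchange relation between the blocks `A` and `V`. -/

section Exchange

variable {K : Type*} [Field K]
variable {α β : Type*} [Fintype α] [DecidableEq α] [Fintype β] [DecidableEq β]

/-- The image of `z^j_i` in `H`. -/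
noncomputable def zGen (R : Matrix ((α ⊕ β) × (α ⊕ β)) ((α ⊕ β) × (α ⊕ β)) K) (j i : α ⊕ β) :
    HopfEnvelope R :=
  RingQuot.mkAlgHom K (HopfRel R) (zFree K j i)

/-- The image of `t^j_i` in `H`. -/
noncomputable def tGen (R : Matrix ((α ⊕ β) × (α ⊕ β)) ((α ⊕ β) × (α ⊕ β)) K) (j i : α ⊕ β) :
    HopfEnvelope R :=
  RingQuot.mkAlgHom K (HopfRel R) (tFree K j i)

variable (R : Matrix ((α ⊕ β) × (α ⊕ β)) ((α ⊕ β) × (α ⊕ β)) K)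

theorem zGen_mul_zGen (k l i j : α ⊕ β) :
    ∑ p, ∑ s, ((-1) ^ (parity s * (parity i + parity p)) * R (k, l) (p, s)) •
        (zGen R p i * zGen R s j) =
      ∑ p, ∑ s, ((-1) ^ (parity l * (parity p + parity k)) * R (p, s) (i, j)) •
        (zGen R k p * zGen R l s) := by
  simpa only [map_sum, map_smul, map_mul, zGen] using
    RingQuot.mkAlgHom_rel K (HopfRel.zz (R := R) k l i j)

theorem sum_zGen_mul_tGen (j i : α ⊕ β) :
    ∑ k, ((-1 : K) ^ (parity i * (parity k + 1))) • (zGen R j k * tGen R k i) =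
      if j = i then 1 else 0 := by
  have := RingQuot.mkAlgHom_rel K (HopfRel.zt (R := R) j i)
  rw [apply_ite (RingQuot.mkAlgHom K (HopfRel R)), map_one, map_zero] at this
  simpa only [map_sum, map_smul, map_mul, zGen, tGen] using this

theorem sum_tGen_mul_zGen (j i : α ⊕ β) :
    ∑ k, ((-1 : K) ^ (parity k * (parity j + 1))) • (tGen R j k * zGen R k i) =
      if j = i then 1 else 0 := by
  have := RingQuot.mkAlgHom_rel K (HopfRel.tz (R := R) j i)
  rw [apply_ite (RingQuot.mkAlgHom K (HopfRel R)), map_one, map_zero] at this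
  simpa only [map_sum, map_smul, map_mul, zGen, tGen] using this

theorem sum_tGen_mul_zGen_odd (a : β) (i : α ⊕ β) :
    ∑ k, tGen R (.inr a) k * zGen R k i = if .inr a = i then 1 else 0 := by
  rw [← sum_tGen_mul_zGen]
  refine Finset.sum_congr rfl fun k _ => ?_
  rw [pow_mul']
  simp [parity]

/-- The quadratic relation between the odd rows of `T` and the even columns of `Z`. -/
theorem tGen_mul_zGen (a b : β) (l i : α) :
    ∑ k, ∑ p, ((-1) ^ (parity p) * R (k, .inl l) (p, .inr b)) •
        (tGen R (.inr a) k * zGen R p (.inl i)) =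
      ∑ j, ∑ s, ((-1) ^ (parity j + 1) * R (.inr a, s) (.inl i, j)) •
        (zGen R (.inl l) s * tGen R j (.inr b)) := by
  -- The relation `zz` is multiplied by `t^a_k` and `t^j_b` and summed. For odd `b` the sign
  -- `(-1)^(ĵ+1)` is the one in `zt`; for odd `a` the sign in `tz` is trivial.
  have e : ∑ k, ∑ j, ((-1 : K) ^ (parity j + 1)) • (tGen R (.inr a) k *
      (∑ p, ∑ s, ((-1) ^ (parity s * parity p) * R (k, .inl l) (p, s)) •
        (zGen R p (.inl i) * zGen R s j)) * tGen R j (.inr b)) =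
      ∑ k, ∑ j, ((-1 : K) ^ (parity j + 1)) • (tGen R (.inr a) k *
      (∑ p, ∑ s, R (p, s) (.inl i, j) • (zGen R k p * zGen R (.inl l) s)) *
        tGen R j (.inr b)) := by
    refine Finset.sum_congr rfl fun k _ => Finset.sum_congr rfl fun j _ => ?_
    have := zGen_mul_zGen R k (.inl l) (.inl i) j
    simp only [show parity (Sum.inl l : α ⊕ β) = 0 from rfl,
      show parity (Sum.inl i : α ⊕ β) = 0 from rfl, zero_mul, zero_add, pow_zero, one_mul] at this
    rw [this]
  have hl : ∀ k, ∑ j, ((-1 : K) ^ (parity j + 1)) • (tGen R (.inr a) k *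
      (∑ p, ∑ s, ((-1) ^ (parity s * parity p) * R (k, .inl l) (p, s)) •
        (zGen R p (.inl i) * zGen R s j)) * tGen R j (.inr b)) =
      ∑ p, ((-1) ^ (parity p) * R (k, .inl l) (p, .inr b)) •
        (tGen R (.inr a) k * zGen R p (.inl i)) := fun k => by
    simp only [Finset.mul_sum, Finset.sum_mul, Finset.smul_sum]
    rw [Finset.sum_comm]
    refine Finset.sum_congr rfl fun p _ => ?_
    rw [Finset.sum_comm]
    have : ∀ s j, ((-1 : K) ^ (parity j + 1)) • (tGen R (.inr a) k *
        (((-1) ^ (parity s * parity p) * R (k, .inl l) (p, s)) •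
        (zGen R p (.inl i) * zGen R s j)) * tGen R j (.inr b)) =
        ((-1) ^ (parity s * parity p) * R (k, .inl l) (p, s)) •
        (tGen R (.inr a) k * zGen R p (.inl i) *
          (((-1 : K) ^ (parity (Sum.inr b : α ⊕ β) * (parity j + 1))) •
            (zGen R s j * tGen R j (.inr b)))) := fun s j => by
      simp only [show parity (Sum.inr b : α ⊕ β) = 1 from rfl, one_mul, mul_smul_comm,
        smul_mul_assoc, mul_assoc]
      rw [smul_comm]
    simp only [this, ← Finset.smul_sum, ← Finset.mul_sum, sum_zGen_mul_tGen]
    simp [parity]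
  have hr : ∀ j, ∑ k, ((-1 : K) ^ (parity j + 1)) • (tGen R (.inr a) k *
      (∑ p, ∑ s, R (p, s) (.inl i, j) • (zGen R k p * zGen R (.inl l) s)) *
        tGen R j (.inr b)) =
      ∑ s, ((-1) ^ (parity j + 1) * R (.inr a, s) (.inl i, j)) •
        (zGen R (.inl l) s * tGen R j (.inr b)) := fun j => by
    simp only [Finset.mul_sum, Finset.sum_mul, Finset.smul_sum]
    rw [Finset.sum_comm, Finset.sum_congr rfl fun p _ => Finset.sum_comm, Finset.sum_comm]
    refine Finset.sum_congr rfl fun s _ => ?_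
    have : ∀ p k, ((-1 : K) ^ (parity j + 1)) • (tGen R (.inr a) k *
        (R (p, s) (.inl i, j) • (zGen R k p * zGen R (.inl l) s)) * tGen R j (.inr b)) =
        ((-1) ^ (parity j + 1) * R (p, s) (.inl i, j)) •
        (tGen R (.inr a) k * zGen R k p * (zGen R (.inl l) s * tGen R j (.inr b))) := fun p k => by
      simp only [mul_smul_comm, smul_mul_assoc, mul_assoc, mul_smul]
    simp only [this, ← Finset.smul_sum, ← Finset.sum_mul, sum_tGen_mul_zGen_odd]
    simp
  rw [Finset.sum_congr rfl fun k _ => hl k] at e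
  rw [e, Finset.sum_comm, Finset.sum_congr rfl fun j _ => hr j]

theorem blockV_mul_blockA (q : K) (Re : Matrix (α × α) (α × α) K) (Ro : Matrix (β × β) (β × β) K)
    (P : Matrix (β × α) (α × β) K) (Q : Matrix (α × β) (β × α) K) (l i : α) (k j : β) :
    ∑ p, ∑ u, braidEntries P l u p j •
        (blockV (gluedOp q Re Ro P Q) k p * blockA (gluedOp q Re Ro P Q) u i) =
      ∑ p, ∑ u, braidEntries P p i k u •
        (blockA (gluedOp q Re Ro P Q) l p * blockV (gluedOp q Re Ro P Q) u j) := by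
  have := tGen_mul_zGen (gluedOp q Re Ro P Q) k j l i
  -- With `l`, `i` even and `k`, `j` odd, only the block `P` of the glued operator contributes, and
  -- all its signs are `+1`.
  simp only [Fintype.sum_sum_type, gluedOp, parity, mul_zero, zero_smul, Finset.sum_const_zero,
    add_zero, zero_add, pow_zero, one_mul] at this
  rw [Finset.sum_comm (f := fun p u => braidEntries P p i k u • _)]
  simpa [braidEntries, blockA, blockV, zGen, tGen] using this

end Exchange

/-! ### Commutation of the determinants, given closed operators. -/

section Commutation

variable {K : Type*} [Field K]
variable {α β : Type*} [Fintype α] [DecidableEq α] [Fintype β] [DecidableEq β]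

theorem contraction_eq {H : Type*} [Ring H] [Algebra K H] {r : ℕ} (F : Matrix α α K)
    (Φ : Matrix (Fin r → α) (Fin r → α) K) (A : Matrix α α H) :
    contraction F Φ A = ∑ I, ∑ L, (scalarPow F r * Φ) I L • tensorPow A r L I := by
  simp only [contraction, Matrix.mul_apply, Finset.sum_smul]
  exact Finset.sum_congr rfl fun I _ => Finset.sum_comm

theorem reversed_opAt (R : Matrix (α × α) (α × α) K) (r i : ℕ) :
    reversed (opAt R r i) = if i + 1 < r then opAt (mirror R) r (r - 2 - i) else 0 := by
  ext J I
  split_ifs with h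
  · have h' : r - 2 - i + 1 < r := by omega
    simp only [reversed, opAt, dif_pos h, dif_pos h']
    have e1 : (⟨i, by omega⟩ : Fin r).rev = ⟨r - 2 - i + 1, h'⟩ := by
      ext; simp [Fin.val_rev]; omega
    have e2 : (⟨i + 1, h⟩ : Fin r).rev = ⟨r - 2 - i, by omega⟩ := by
      ext; simp [Fin.val_rev]; omega
    have e3 : (∀ a : Fin r, a.val ≠ i → a.val ≠ i + 1 → J a.rev = I a.rev) ↔
        ∀ a : Fin r, a.val ≠ r - 2 - i → a.val ≠ r - 2 - i + 1 → J a = I a := by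
      rw [Fin.rev_surjective.forall (p := fun a => a.val ≠ r - 2 - i → _)]
      refine forall_congr' fun a => ?_
      have := a.isLt
      rw [Fin.val_rev]
      constructor
      · intro h a1 a2; exact h (by omega) (by omega)
      · intro h a1 a2; exact h (by omega) (by omega)
    simp only [e1, e2, e3, mirror_apply]
  · simp [reversed, opAt, h]

/-- Reversal is an algebra automorphism carrying the slots of `R` to those of `mirror R`, so the
generators suffice. -/
theorem reversed_mem_scalarCentralizer {B : Type*} [Ring B] [Algebra K B]
    {R : Matrix (α × α) (α × α) K} {L : Matrix α α B} (h : Intertwines (mirror R) L) (c : K)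
    (r : ℕ) : reversed (heckeSum R c r) ∈ scalarCentralizer K (tensorPow L r) := by
  let e : (Fin r → α) ≃ (Fin r → α) := Fin.revPerm.arrowCongr (Equiv.refl α)
  let f : Matrix (Fin r → α) (Fin r → α) K →ₐ[K] Matrix (Fin r → α) (Fin r → α) K :=
    (Matrix.reindexAlgEquiv K K e).toAlgHom
  have hrev : ∀ Φ, f Φ = reversed Φ := fun Φ => by ext I J; rfl
  have : heckeSum R c r ∈ (scalarCentralizer K (tensorPow L r)).comap f := by
    refine heckeSum_mem _ (fun i => ?_) c
    rw [Subalgebra.mem_comap, hrev, reversed_opAt]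
    split_ifs
    · exact mem_scalarCentralizer.2 (opAt_commute_tensorPow h _ _)
    · exact zero_mem _
  rwa [Subalgebra.mem_comap, hrev] at this

/-- The quantum traces with antisymmetrizer and symmetrizer commute for closed operators that
satisfy the mixed relations. -/
theorem commute_contraction {H : Type*} [Ring H] [Algebra K H]
    (q : K) {Re : Matrix (α × α) (α × α) K} {Ro : Matrix (β × β) (β × β) K}
    (hRe : IsClosedOp Re) (hRo : IsClosedOp Ro)
    {P : Matrix (β × α) (α × β) K} {Q : Matrix (α × β) (β × α) K} (hP : P * Q = 1) (hP' : Q * P = 1)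
    (hPe : onLeft α P * onRight α P * onLeft β Re = onRight β Re * onLeft α P * onRight α P)
    (hPo : onRight β P * onLeft β P * onRight α Ro = onLeft α Ro * onRight β P * onLeft β P)
    {A : Matrix α α H} {V : Matrix β β H}
    (hAV : ∀ l i k j, ∑ p, ∑ u, braidEntries P l u p j • (V k p * A u i) =
      ∑ p, ∑ u, braidEntries P p i k u • (A l p * V u j)) (r s : ℕ) :
    Commute (contraction (traceF Re) (antisymmetrizer q Re r) A)
      (contraction (traceG Ro) (reversed (symmetrizer q Ro s)) V) := by
  have hL := braidEntries_mul_inv hP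
  have hL' := braidInvEntries_mul hP'
  have hIe := intertwines_braidEntries hPe
  have hIo := intertwines_flip_braidEntries hPo
  have hG : IsTraceWeight (flip (braidEntries P)) (flip (braidInvEntries Q)) (traceG Ro) := by
    rw [traceG_eq_mirror]
    exact isTraceWeight_of_intertwines (isSkewInverse_skewInv hRo).mirror (flip_mul_flip hL)
      (flip_mul_flip hL') hIo
  have base : TraceSystem (braidEntries P) (braidInvEntries Q) (traceF Re) (traceG Ro) A V :=
    { mul_eq_one := hL
      mul_eq_one' := hL'
      left_weight := isTraceWeight_of_intertwines (isSkewInverse_skewInv hRe) hL hL' hIe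
      right_weight := TraceSystem.right_weight_iff.2 hG
      exchange := TraceSystem.exchange_iff.2 hAV }
  have hΦ : antisymmetrizer q Re r ∈ scalarCentralizer K (tensorPow (braidEntries P) r) := by
    unfold antisymmetrizer
    exact Subalgebra.smul_mem _ (heckeSum_mem _ (fun i =>
      mem_scalarCentralizer.2 (opAt_commute_tensorPow hIe r i)) _) _
  -- The second passage to powers takes place after the first, so the operator to commute with is
  -- built from `tensorPow (braidEntries P) r`.
  have hΨ : reversed (symmetrizer q Ro s) ∈ scalarCentralizer K
      (tensorPow (flip (tensorPow (braidEntries P) r)) s) := by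
    have e : reversed (symmetrizer q Ro s) =
        (qFactorial q s)⁻¹ • reversed (heckeSum Ro 1 s) := by ext I J; rfl
    rw [e]
    exact Subalgebra.smul_mem _ (reversed_mem_scalarCentralizer (hIo.flip_tensorPow r) 1 s) _
  rw [contraction_eq, contraction_eq]
  exact ((base.tensorPow r hΦ).flip.tensorPow s hΨ).commute_trace.symm

/-- The quantum determinants commute for closed operators that satisfy the mixed relations. -/
theorem commute_detA_detV (q : K) {Re : Matrix (α × α) (α × α) K} {Ro : Matrix (β × β) (β × β) K}
    (hRe : IsClosedOp Re) (hRo : IsClosedOp Ro)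
    {P : Matrix (β × α) (α × β) K} {Q : Matrix (α × β) (β × α) K} (hP : P * Q = 1) (hP' : Q * P = 1)
    (hPe : onLeft α P * onRight α P * onLeft β Re = onRight β Re * onLeft α P * onRight α P)
    (hPo : onRight β P * onLeft β P * onRight α Ro = onLeft α Ro * onRight β P * onLeft β P)
    (Q' : Matrix (α × β) (β × α) K) (r s : ℕ) :
    Commute (detA q Re r (gluedOp q Re Ro P Q')) (detV q Ro s (gluedOp q Re Ro P Q')) :=
  ((commute_contraction q hRe hRo hP hP' hPe hPo
    (blockV_mul_blockA q Re Ro P Q') r s).smul_left _).smul_right _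

end Commutation

/-! ### Alternating functions and the quantum exterior algebra. -/

section Alternating

variable {K : Type*} [Field K] {ι : Type*} [Fintype ι] [DecidableEq ι]

/-- The generator `x_a` of the quantum exterior algebra. -/
noncomputable def extGen (R : Matrix (ι × ι) (ι × ι) K) (a : ι) : QuantumExterior R :=
  RingQuot.mkAlgHom K (ExteriorRel R) (FreeAlgebra.ι K a)

theorem sum_extGen_mul (R : Matrix (ι × ι) (ι × ι) K) (k l : ι) :
    ∑ i, ∑ j, R (i, j) (k, l) • (extGen R i * extGen R j) = -(extGen R k * extGen R l) := by
  simpa only [map_sum, map_smul, map_mul, map_neg, extGen] using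
    RingQuot.mkAlgHom_rel K (ExteriorRel.rel (R := R) k l)

/-- Alternating functions on words: the functionals on `T(V)` that vanish on the ideal of
relations of `Λ`. -/
def alternatingWords (R : Matrix (ι × ι) (ι × ι) K) : Submodule K (List ι → K) where
  carrier := {f | ∀ u k l v, ∑ a, ∑ b, R (a, b) (k, l) * f (u ++ a :: b :: v) =
    -f (u ++ k :: l :: v)}
  add_mem' {f g} hf hg u k l v := by
    simp only [Pi.add_apply, mul_add, Finset.sum_add_distrib, hf u k l v, hg u k l v]
    ring
  zero_mem' u k l v := by simp
  smul_mem' c f hf u k l v := by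
    simp only [Pi.smul_apply, smul_eq_mul, mul_left_comm _ c, ← Finset.mul_sum, hf u k l v]
    ring

/-- Contraction of an alternating function with `x_a` on the left. -/
def contractWord (R : Matrix (ι × ι) (ι × ι) K) (a : ι) :
    alternatingWords R →ₗ[K] alternatingWords R where
  toFun f := ⟨fun w => f.1 (a :: w), fun u => f.2 (a :: u)⟩
  map_add' _ _ := rfl
  map_smul' _ _ := rfl

/-- The right action of `Λ` on the alternating functions. -/
noncomputable def extAction (R : Matrix (ι × ι) (ι × ι) K) :
    QuantumExterior R →ₐ[K] (Module.End K (alternatingWords R))ᵐᵒᵖ :=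
  RingQuot.liftAlgHom K ⟨FreeAlgebra.lift K fun a => MulOpposite.op (contractWord R a), by
    rintro _ _ ⟨k, l⟩
    simp only [map_sum, map_smul, map_mul, map_neg, FreeAlgebra.lift_ι_apply]
    apply MulOpposite.unop_injective
    ext f w
    simpa [contractWord] using f.2 [] k l w⟩

theorem extAction_prod (R : Matrix (ι × ι) (ι × ι) K) (l : List ι) (f : alternatingWords R)
    (w : List ι) :
    ((extAction R (l.map (extGen R)).prod).unop f).1 w = f.1 (l ++ w) := by
  induction l generalizing f with
  | nil => simp
  | cons a l ih =>
    have h : extAction R (extGen R a) = MulOpposite.op (contractWord R a) := by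
      simp [extAction, extGen]
    simp only [List.map_cons, List.prod_cons, map_mul, MulOpposite.unop_mul, Module.End.mul_apply,
      ih, h]
    rfl

theorem list_prod_mem_exteriorPart (R : Matrix (ι × ι) (ι × ι) K) (l : List ι) :
    (l.map (extGen R)).prod ∈ exteriorPart R l.length := by
  induction l with
  | nil =>
    rw [List.map_nil, List.prod_nil, List.length_nil, exteriorPart, pow_zero]
    exact Submodule.one_le.1 le_rfl
  | cons a l ih =>
    rw [List.map_cons, List.prod_cons, List.length_cons, exteriorPart, pow_succ']
    exact Submodule.mul_mem_mul (Submodule.subset_span ⟨a, rfl⟩) ih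

/-- The value `f l` is recovered from the action on `f` of the product of the letters of `l` in `Λ`,
and that product lies in a zero component. -/
theorem alternatingWords_apply_eq_zero {R : Matrix (ι × ι) (ι × ι) K} {f : List ι → K}
    (hf : f ∈ alternatingWords R) {l : List ι} (h : exteriorPart R l.length = ⊥) : f l = 0 := by
  have h0 := list_prod_mem_exteriorPart R l
  rw [h, Submodule.mem_bot] at h0
  have := extAction_prod R l ⟨f, hf⟩ []
  rw [h0] at this
  simpa using this.symm

/-- The operator `R` on the positions `i`, `i + 1`, applied from the right to a function of an
infinite word. -/
def slotAct (R : Matrix (ι × ι) (ι × ι) K) : ℕ → (Stream' ι → K) → Stream' ι → K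
  | 0, f, w => ∑ a, ∑ b, R (a, b) (w.head, w.tail.head) * f (.cons a (.cons b w.tail.tail))
  | i + 1, f, w => slotAct R i (fun v => f (.cons w.head v)) w.tail

theorem slotAct_zero (R : Matrix (ι × ι) (ι × ι) K) (f : Stream' ι → K) (k l : ι)
    (w : Stream' ι) : slotAct R 0 f (.cons k (.cons l w)) =
      ∑ a, ∑ b, R (a, b) (k, l) * f (.cons a (.cons b w)) := rfl

theorem slotAct_succ (R : Matrix (ι × ι) (ι × ι) K) (i : ℕ) (f : Stream' ι → K) (k : ι)
    (w : Stream' ι) : slotAct R (i + 1) f (.cons k w) = slotAct R i (fun v => f (.cons k v)) w :=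
  rfl

theorem exists_eq_cons (w : Stream' ι) : ∃ k v, w = .cons k v :=
  ⟨w.head, w.tail, (Stream'.eta w).symm⟩

theorem slotAct_zero_eq_vecMul (R : Matrix (ι × ι) (ι × ι) K) (f : Stream' ι → K) (k l : ι)
    (w : Stream' ι) : slotAct R 0 f (.cons k (.cons l w)) =
      Matrix.vecMul (fun p : ι × ι => f (.cons p.1 (.cons p.2 w))) R (k, l) := by
  simp only [slotAct_zero, Matrix.vecMul, dotProduct, Fintype.sum_prod_type, mul_comm]

theorem slotAct_zero_eq_vecMul_onLeft (R : Matrix (ι × ι) (ι × ι) K) (f : Stream' ι → K)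
    (k l n : ι) (w : Stream' ι) : slotAct R 0 f (.cons k (.cons l (.cons n w))) =
      Matrix.vecMul (fun p : ι × ι × ι => f (.cons p.1 (.cons p.2.1 (.cons p.2.2 w))))
        (onLeft ι R) (k, l, n) := by
  simp [slotAct_zero, Matrix.vecMul, dotProduct, Fintype.sum_prod_type, mul_comm, onLeft_apply]

theorem slotAct_one_eq_vecMul_onRight (R : Matrix (ι × ι) (ι × ι) K) (f : Stream' ι → K)
    (k l n : ι) (w : Stream' ι) : slotAct R 1 f (.cons k (.cons l (.cons n w))) =
      Matrix.vecMul (fun p : ι × ι × ι => f (.cons p.1 (.cons p.2.1 (.cons p.2.2 w))))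
        (onRight ι R) (k, l, n) := by
  rw [slotAct_succ, slotAct_zero]
  simp [Matrix.vecMul, dotProduct, Fintype.sum_prod_type, mul_comm, onRight_apply,
    Finset.sum_ite_irrel]

theorem slotAct_sum_smul (R : Matrix (ι × ι) (ι × ι) K) {σ : Type*} (s : Finset σ) (c : σ → K)
    (f : σ → Stream' ι → K) (i : ℕ) (w : Stream' ι) :
    slotAct R i (fun v => ∑ x ∈ s, c x * f x v) w = ∑ x ∈ s, c x * slotAct R i (f x) w := by
  induction i generalizing f w with
  | zero =>
    simp only [slotAct, Finset.mul_sum]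
    rw [Finset.sum_congr rfl fun a _ => Finset.sum_comm, Finset.sum_comm]
    simp only [mul_left_comm]
  | succ i ih => exact ih _ _

theorem slotAct_neg (R : Matrix (ι × ι) (ι × ι) K) (f : Stream' ι → K) (i : ℕ) :
    slotAct R i (-f) = -slotAct R i f := by
  ext w
  have := slotAct_sum_smul R {()} (fun _ => (-1 : K)) (fun _ => f) i w
  simpa [Pi.neg_def] using this

/-- On infinite words all slots act on one function space. Prefixing a letter shifts the slot, so an
operator identity need only be checked at the front, where it is a vector-matrix product. -/
theorem slotAct_hecke {q : K} {R : Matrix (ι × ι) (ι × ι) K}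
    (h : (R + 1) * (R - q • (1 : Matrix (ι × ι) (ι × ι) K)) = 0) (i : ℕ) (f : Stream' ι → K)
    (w : Stream' ι) :
    slotAct R i (slotAct R i f) w = (q - 1) * slotAct R i f w + q * f w := by
  have h2 : R * R = (q - 1) • R + q • (1 : Matrix (ι × ι) (ι × ι) K) := by
    have : (R + 1) * (R - q • (1 : Matrix (ι × ι) (ι × ι) K)) =
        R * R - ((q - 1) • R + q • (1 : Matrix (ι × ι) (ι × ι) K)) := by
      simp only [mul_sub, add_mul, one_mul, mul_smul_comm, mul_one, sub_smul, one_smul, smul_add]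
      abel
    rw [this] at h
    exact sub_eq_zero.1 h
  induction i generalizing f w with
  | zero =>
    obtain ⟨k, w, rfl⟩ := exists_eq_cons w
    obtain ⟨l, w, rfl⟩ := exists_eq_cons w
    simp only [slotAct_zero_eq_vecMul, Prod.mk.eta, Matrix.vecMul_vecMul, h2, Matrix.vecMul_add,
      Matrix.vecMul_smul, Matrix.vecMul_one, Pi.add_apply, Pi.smul_apply, smul_eq_mul]
  | succ i ih =>
    obtain ⟨k, w, rfl⟩ := exists_eq_cons w
    exact ih (fun v => f (.cons k v)) w

theorem slotAct_comm (R : Matrix (ι × ι) (ι × ι) K) {i j : ℕ} (h : i + 2 ≤ j) (f : Stream' ι → K)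
    (w : Stream' ι) : slotAct R i (slotAct R j f) w = slotAct R j (slotAct R i f) w := by
  induction i generalizing j f w with
  | zero =>
    obtain ⟨j, rfl⟩ := Nat.exists_eq_add_of_le' h
    obtain ⟨k, w, rfl⟩ := exists_eq_cons w
    obtain ⟨l, w, rfl⟩ := exists_eq_cons w
    simp only [slotAct_zero, slotAct_succ]
    have := slotAct_sum_smul R Finset.univ (fun p : ι × ι => R (p.1, p.2) (k, l))
      (fun p v => f (.cons p.1 (.cons p.2 v))) j w
    simpa only [Fintype.sum_prod_type] using this.symm
  | succ i ih =>
    obtain ⟨j, rfl⟩ : ∃ j', j = j' + 1 := ⟨j - 1, by omega⟩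
    obtain ⟨k, w, rfl⟩ := exists_eq_cons w
    exact ih (j := j) (by omega) (fun v => f (.cons k v)) w

theorem slotAct_braid {R : Matrix (ι × ι) (ι × ι) K}
    (h : onLeft ι R * onRight ι R * onLeft ι R = onRight ι R * onLeft ι R * onRight ι R) (i : ℕ)
    (f : Stream' ι → K) (w : Stream' ι) :
    slotAct R i (slotAct R (i + 1) (slotAct R i f)) w =
      slotAct R (i + 1) (slotAct R i (slotAct R (i + 1) f)) w := by
  induction i generalizing f w with
  | zero =>
    obtain ⟨k, w, rfl⟩ := exists_eq_cons w
    obtain ⟨l, w, rfl⟩ := exists_eq_cons w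
    obtain ⟨n, w, rfl⟩ := exists_eq_cons w
    simp only [zero_add, slotAct_zero_eq_vecMul_onLeft, slotAct_one_eq_vecMul_onRight,
      Prod.mk.eta, Matrix.vecMul_vecMul, h]
  | succ i ih =>
    obtain ⟨k, w, rfl⟩ := exists_eq_cons w
    exact ih (fun v => f (.cons k v)) w

/-- The function `f` on infinite words is multiplied by `-1` by `R_i` for all `i < n`. -/
def IsAlternatingBelow (R : Matrix (ι × ι) (ι × ι) K) (n : ℕ) (f : Stream' ι → K) : Prop :=
  ∀ i < n, slotAct R i f = -f

theorem slotAct_append (R : Matrix (ι × ι) (ι × ι) K) (f : Stream' ι → K) (u : List ι) (k l : ι)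
    (w : Stream' ι) : slotAct R u.length f (u ++ₛ (.cons k (.cons l w))) =
      ∑ a, ∑ b, R (a, b) (k, l) * f (u ++ₛ (.cons a (.cons b w))) := by
  induction u generalizing f with
  | nil => exact slotAct_zero R f k l w
  | cons c u ih => exact ih _

theorem IsAlternatingBelow.eq_zero {R : Matrix (ι × ι) (ι × ι) K} {n : ℕ} {f : Stream' ι → K}
    (h : IsAlternatingBelow R n f) (hn : exteriorPart R (n + 1) = ⊥) : f = 0 := by
  ext w
  -- The letters after the first `n + 1` are frozen, which turns `f` into a function on words of
  -- that length.
  let g : List ι → K := fun l => if l.length = n + 1 then f (l ++ₛ w.drop (n + 1)) else 0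
  have hg : g ∈ alternatingWords R := by
    intro u k l v
    by_cases hl : (u ++ k :: l :: v).length = n + 1
    · have hl' : ∀ a b, (u ++ a :: b :: v).length = n + 1 := fun a b => by simpa using hl
      simp only [g, hl', if_true, Stream'.append_append_stream, Stream'.cons_append_stream]
      rw [← slotAct_append, h u.length (by simp at hl; omega)]
      rfl
    · have hl' : ∀ a b, (u ++ a :: b :: v).length ≠ n + 1 := fun a b => by simpa using hl
      simp only [g, hl', if_false, mul_zero, Finset.sum_const_zero, neg_zero]
  have := alternatingWords_apply_eq_zero hg (l := w.take (n + 1)) (by simpa using hn)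
  simpa [g, Stream'.append_take_drop] using this

/-- The product of the first `n` letters in `Λ`. -/
noncomputable def extProd (R : Matrix (ι × ι) (ι × ι) K) : ℕ → Stream' ι → QuantumExterior R
  | 0, _ => 1
  | n + 1, w => extGen R w.head * extProd R n w.tail

theorem isAlternatingBelow_extProd (R : Matrix (ι × ι) (ι × ι) K) (n : ℕ)
    (φ : QuantumExterior R →ₗ[K] K) :
    IsAlternatingBelow R (n - 1) fun w => φ (extProd R n w) := by
  intro i hi
  induction i generalizing n φ with
  | zero =>
    obtain ⟨n, rfl⟩ : ∃ n', n = n' + 2 := ⟨n - 2, by omega⟩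
    ext w
    obtain ⟨k, w, rfl⟩ := exists_eq_cons w
    obtain ⟨l, w, rfl⟩ := exists_eq_cons w
    change slotAct R 0 _ _ = -φ (extProd R (n + 2) (.cons k (.cons l w)))
    have : φ ((∑ i, ∑ j, R (i, j) (k, l) • (extGen R i * extGen R j)) * extProd R n w) =
        -φ (extGen R k * extGen R l * extProd R n w) := by
      rw [sum_extGen_mul]
      exact (congrArg φ (neg_mul _ _)).trans (map_neg φ _)
    simpa only [slotAct_zero, extProd, Stream'.head_cons, Stream'.tail_cons, Finset.sum_mul,
      map_sum, smul_mul_assoc, map_smul, neg_mul, map_neg, mul_assoc, smul_eq_mul] using this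
  | succ i ih =>
    obtain ⟨n, rfl⟩ : ∃ n', n = n' + 1 := ⟨n - 1, by omega⟩
    ext w
    obtain ⟨k, w, rfl⟩ := exists_eq_cons w
    exact congrFun (ih n (φ ∘ₗ LinearMap.mulLeft K (extGen R k)) (by omega)) w

theorem exists_extProd_ne_zero {R : Matrix (ι × ι) (ι × ι) K} {n : ℕ} (a : ι)
    (h : exteriorPart R n ≠ ⊥) : ∃ w, extProd R n w ≠ 0 := by
  by_contra! h0
  apply h
  have : ∀ n, exteriorPart R n ≤ Submodule.span K (Set.range (extProd R n)) := fun n => by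
    induction n with
    | zero =>
      rw [exteriorPart, pow_zero, Submodule.one_eq_span]
      -- The letter `a` serves only to provide an infinite word.
      exact Submodule.span_mono (Set.singleton_subset_iff.2 ⟨Stream'.const a, rfl⟩)
    | succ n ih =>
      rw [exteriorPart, pow_succ']
      refine (mul_le_mul' le_rfl ih).trans ?_
      rw [Submodule.span_mul_span, Submodule.span_le]
      rintro _ ⟨_, ⟨k, rfl⟩, _, ⟨w, rfl⟩, rfl⟩
      exact Submodule.subset_span ⟨.cons k w, rfl⟩
  refine eq_bot_iff.2 ((this n).trans ?_)
  rw [Submodule.span_le]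
  rintro _ ⟨w, rfl⟩
  simp [h0]

end Alternating

/-! ### The quantum dimension of an even Hecke operator. -/

section QuantumDimension

variable {K : Type*} [Field K] {ι : Type*} [Fintype ι] [DecidableEq ι]

/-- The function `f R_0 R_1 ⋯ R_{j-1}`. -/
def slotChain (R : Matrix (ι × ι) (ι × ι) K) (f : Stream' ι → K) : ℕ → Stream' ι → K
  | 0 => f
  | j + 1 => slotAct R j (slotChain R f j)

variable {q : K} {R : Matrix (ι × ι) (ι × ι) K} {n : ℕ} {f : Stream' ι → K}

theorem slotAct_slotChain_of_le (hf : ∀ i < n, slotAct R (i + 1) f = -f) {i j : ℕ} (hij : j ≤ i)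
    (hi : i < n) : slotAct R (i + 1) (slotChain R f j) = -slotChain R f j := by
  induction j with
  | zero => exact hf i hi
  | succ j ih =>
    have e := funext fun w => slotAct_comm R (show j + 2 ≤ i + 1 by omega) (slotChain R f j) w
    rw [slotChain, ← e, ih (by omega), slotAct_neg]

/-- The braid relation turns `R_i R_{i+1} R_i` into `R_{i+1} R_i R_{i+1}`; the leading `R_{i+1}`
commutes past the earlier factors and meets `f`, where it acts by `-1`. -/
theorem slotAct_slotChain_of_lt
    (hR : onLeft ι R * onRight ι R * onLeft ι R = onRight ι R * onLeft ι R * onRight ι R)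
    (hf : ∀ i < n, slotAct R (i + 1) f = -f) {i j : ℕ} (hij : i + 2 ≤ j) (hi : i < n) :
    slotAct R i (slotChain R f j) = -slotChain R f j := by
  induction j, hij using Nat.le_induction with
  | base =>
    simp only [slotChain]
    rw [funext fun w => slotAct_braid hR i (slotChain R f i) w,
      slotAct_slotChain_of_le hf le_rfl hi, slotAct_neg, slotAct_neg]
  | succ j hj ih =>
    have e := funext fun w => slotAct_comm R hj (slotChain R f j) w
    rw [slotChain, e, ih, slotAct_neg]

/-- Antisymmetrization of a function that is alternating in all letters but the first. -/
theorem isAlternatingBelow_sum_slotChain (hq : q ≠ 0)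
    (hR : (R + 1) * (R - q • (1 : Matrix (ι × ι) (ι × ι) K)) = 0)
    (hR' : onLeft ι R * onRight ι R * onLeft ι R = onRight ι R * onLeft ι R * onRight ι R)
    (hf : ∀ i, i + 1 < n → slotAct R (i + 1) f = -f) :
    IsAlternatingBelow R n
      fun w => ∑ j ∈ Finset.range (n + 1), (-q⁻¹) ^ j * slotChain R f j w := by
  intro i hi
  ext w
  -- `R_i` acts by `-1` on every summand except `j = i` and `j = i + 1`; `R_i + 1` annihilates the
  -- sum of these two by the Hecke equation.
  rw [slotAct_sum_smul, ← sub_eq_zero, Pi.neg_apply, sub_neg_eq_add, ← Finset.sum_add_distrib,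
    Finset.sum_eq_add i (i + 1) (by omega)]
  · have h1 : slotAct R i (slotChain R f (i + 1)) w =
        (q - 1) * slotChain R f (i + 1) w + q * slotChain R f i w := slotAct_hecke hR i _ w
    rw [h1, show slotAct R i (slotChain R f i) = slotChain R f (i + 1) from rfl, pow_succ]
    field_simp
    ring
  · intro j hj hne
    rw [Finset.mem_range] at hj
    have : slotAct R i (slotChain R f j) = -slotChain R f j := by
      rcases lt_or_gt_of_ne hne.1 with h | h
      · obtain ⟨i, rfl⟩ : ∃ i', i = i' + 1 := ⟨i - 1, by omega⟩
        exact slotAct_slotChain_of_le (n := n - 1) (fun i hi => hf i (by omega)) (by omega)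
          (by omega)
      · exact slotAct_slotChain_of_lt hR' (n := n - 1) (fun i hi => hf i (by omega)) (by omega)
          (by omega)
    rw [this]
    simp
  · intro h; simp at h; omega
  · intro h; simp at h; omega

/-- Contraction of the first letter of a family of functions with the weight `F`. -/
def firstTrace (F : Matrix ι ι K) (g : ι → Stream' ι → K) : Stream' ι → K :=
  fun v => ∑ b, ∑ k, F k b * g b (.cons k v)

theorem firstTrace_slotAct_succ (F : Matrix ι ι K) (R : Matrix (ι × ι) (ι × ι) K)
    (g : ι → Stream' ι → K) (i : ℕ) :
    firstTrace F (fun b => slotAct R (i + 1) (g b)) = slotAct R i (firstTrace F g) := by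
  ext v
  have := slotAct_sum_smul R Finset.univ (fun p : ι × ι => F p.2 p.1)
      (fun p v => g p.1 (.cons p.2 v)) i v
  simp only [Fintype.sum_prod_type] at this
  exact this.symm

/-- The function `x_b^* ⊗ φ`. -/
def deltaCons (φ : Stream' ι → K) (b : ι) : Stream' ι → K :=
  fun w => (1 : Matrix ι ι K) w.head b * φ w.tail

theorem deltaCons_cons (φ : Stream' ι → K) (b k : ι) (w : Stream' ι) :
    deltaCons φ b (.cons k w) = (1 : Matrix ι ι K) k b * φ w := rfl

theorem firstTrace_deltaCons (F : Matrix ι ι K) (φ : Stream' ι → K) :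
    firstTrace F (deltaCons φ) = fun v => F.trace * φ v := by
  ext v
  simp [firstTrace, deltaCons_cons, Matrix.one_apply, Matrix.trace, Finset.sum_mul]

theorem sum_traceF_mul (h : IsSkewInverse R (skewInv R)) (k l : ι) :
    ∑ b, ∑ m, traceF R m b * R (b, k) (m, l) = if k = l then 1 else 0 := by
  have e : ∀ a, ∑ b, ∑ m, skewInv R (a, m) (a, b) * R (b, k) (m, l) =
      (if a = k then 1 else 0) * (if a = l then 1 else 0) := fun a => h.2 a k a l
  simp only [traceF, Finset.sum_mul]
  rw [Finset.sum_congr rfl fun b _ => Finset.sum_comm, Finset.sum_comm,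
    Finset.sum_congr rfl fun a _ => e a]
  simp [eq_comm]

/-- `R_0` couples the traced letter to the first letter of `φ`, and the weighted partial trace of
`R` is the identity. -/
theorem firstTrace_slotAct_zero_deltaCons (h : IsSkewInverse R (skewInv R)) (φ : Stream' ι → K) :
    firstTrace (traceF R) (fun b => slotAct R 0 (deltaCons φ b)) = φ := by
  ext v
  obtain ⟨l, v, rfl⟩ := exists_eq_cons v
  simp only [firstTrace, slotAct_zero, deltaCons_cons, Matrix.one_apply]
  calc _ = ∑ k, (∑ b, ∑ m, traceF R m b * R (b, k) (m, l)) * φ (.cons k v) := by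
        simp only [Finset.sum_mul, ite_mul, one_mul, zero_mul, mul_ite, mul_zero,
          Finset.sum_ite_irrel, Finset.sum_const_zero, Finset.sum_ite_eq', Finset.mem_univ,
          if_true, Finset.mul_sum, mul_assoc]
        rw [Finset.sum_congr rfl fun b _ => Finset.sum_comm, Finset.sum_comm]
    _ = _ := by simp [sum_traceF_mul h]

theorem slotAct_deltaCons (φ : Stream' ι → K) (b : ι) (i : ℕ) :
    slotAct R (i + 1) (deltaCons φ b) = deltaCons (slotAct R i φ) b := by
  ext w
  obtain ⟨k, w, rfl⟩ := exists_eq_cons w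
  have := slotAct_sum_smul R {()} (fun _ => (1 : Matrix ι ι K) k b) (fun _ => φ) i w
  simp only [Finset.sum_singleton] at this
  exact this

/-- The quantum dimension of an even Hecke operator of rank `r` is `q^{-1} + ⋯ + q^{-r}`. -/
theorem trace_traceF {r : ℕ} (hq : q ≠ 0) (hR : IsEvenHecke q R) (hr : HasEvenRank R r) :
    (traceF R).trace = ∑ j ∈ Finset.range r, q⁻¹ ^ (j + 1) := by
  have hS := isSkewInverse_skewInv hR.closed
  have hbot : exteriorPart R (r + 1) = ⊥ := by
    by_contra h
    exact absurd (hr.2 h) (by omega)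
  -- Over an empty alphabet there are no infinite words, so this case is separate.
  rcases isEmpty_or_nonempty ι with hι | ⟨⟨a⟩⟩
  · obtain rfl : r = 0 := by
      by_contra h
      refine hr.1 ?_
      rw [exteriorPart, Set.range_eq_empty, Submodule.span_empty, Submodule.bot_pow h]
    simp [Matrix.trace]
  obtain ⟨w, hw⟩ := exists_extProd_ne_zero a hr.1
  obtain ⟨lam, hlam⟩ : ∃ lam : QuantumExterior R →ₗ[K] K, lam (extProd R r w) ≠ 0 := by
    by_contra! h
    exact hw ((Module.forall_dual_apply_eq_zero_iff K _).1 h)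
  set φ : Stream' ι → K := fun w => lam (extProd R r w) with hφ
  have alt : IsAlternatingBelow R (r - 1) φ := isAlternatingBelow_extProd R r lam
  -- Antisymmetrizing `x_b^* ⊗ φ` gives an alternating function of `r + 1` letters, one more than
  -- the top degree.
  have zero : ∀ b, (fun w => ∑ j ∈ Finset.range (r + 1),
      (-q⁻¹) ^ j * slotChain R (deltaCons φ b) j w) = 0 := fun b => by
    refine (isAlternatingBelow_sum_slotChain hq hR.hecke hR.yangBaxter fun i hi => ?_).eq_zero hbot
    rw [slotAct_deltaCons, alt i (by omega)]
    ext w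
    simp [deltaCons]
  -- Tracing consumes `R_0` and lowers the other slots by one; each of the remaining `j` factors
  -- acts on `φ` by `-1`.
  have tr : ∀ j < r, firstTrace (traceF R) (fun b => slotChain R (deltaCons φ b) (j + 1)) =
      fun v => (-1) ^ j * φ v := fun j => by
    induction j with
    | zero =>
      intro _
      simpa [slotChain] using firstTrace_slotAct_zero_deltaCons hS φ
    | succ j ih =>
      intro hj
      simp only [slotChain] at ih ⊢
      rw [firstTrace_slotAct_succ, ih (by omega)]
      ext v
      have := slotAct_sum_smul R {()} (fun _ => (-1 : K) ^ j) (fun _ => φ) j v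
      simp only [Finset.sum_singleton] at this
      rw [this, alt j (by omega), pow_succ]
      simp
  have total : ∑ j ∈ Finset.range (r + 1), (-q⁻¹) ^ j *
      firstTrace (traceF R) (fun b => slotChain R (deltaCons φ b) j) w = 0 := by
    have : ∑ b, ∑ k, traceF R k b * (∑ j ∈ Finset.range (r + 1),
        (-q⁻¹) ^ j * slotChain R (deltaCons φ b) j (.cons k w)) = 0 := by
      refine Finset.sum_eq_zero fun b _ => Finset.sum_eq_zero fun k _ => ?_
      rw [congrFun (zero b) (.cons k w)]
      simp
    rw [← this]
    simp only [firstTrace, Finset.mul_sum]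
    rw [Finset.sum_comm]
    refine Finset.sum_congr rfl fun b _ => ?_
    rw [Finset.sum_comm]
    simp only [mul_left_comm]
  rw [Finset.sum_range_succ', show (fun b => slotChain R (deltaCons φ b) 0) = deltaCons φ from rfl,
    firstTrace_deltaCons, Finset.sum_congr rfl fun j hj => by
      rw [tr j (Finset.mem_range.1 hj)]] at total
  have e : ∀ j, (-q⁻¹) ^ (j + 1) * ((-1) ^ j * φ w) = -(q⁻¹ ^ (j + 1)) * φ w := fun j => by
    rw [neg_pow q⁻¹, pow_succ (-1 : K), show (-1 : K) ^ j * -1 * q⁻¹ ^ (j + 1) * ((-1) ^ j * φ w) =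
      -(((-1) ^ j * (-1) ^ j) * q⁻¹ ^ (j + 1) * φ w) by ring, ← mul_pow]
    simp
  simp only [e, ← Finset.sum_mul, pow_zero, one_mul, ← add_mul] at total
  have := (mul_eq_zero.1 total).resolve_right hlam
  rw [Finset.sum_neg_distrib] at this
  linear_combination this

theorem quantumDimension_ne {r : ℕ} (hq : q ≠ 0) (hR : IsEvenHecke q R) (hr : HasEvenRank R r) :
    (q - 1) * (traceF R).trace ≠ 1 := by
  have e : ∀ r, (q - 1) * ∑ j ∈ Finset.range r, q⁻¹ ^ (j + 1) = 1 - q⁻¹ ^ r := fun r => by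
    induction r with
    | zero => simp
    | succ r ih =>
      rw [Finset.sum_range_succ, mul_add, ih, pow_succ]
      field_simp
      ring
  rw [trace_traceF hq hR hr, e]
  intro h
  have : q⁻¹ ^ r = 0 := by linear_combination -h
  exact pow_ne_zero r (inv_ne_zero hq) this

end QuantumDimension

/-! ### Closedness of odd Hecke operators. -/

section ClosedPerturbation

variable {K : Type*} [Field K] {ι : Type*} [Fintype ι] [DecidableEq ι]

/-- The partial transpose of `R`, of which the skew inverse is the inverse matrix. -/
def partialTranspose (R : Matrix (ι × ι) (ι × ι) K) : Matrix (ι × ι) (ι × ι) K :=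
  fun x y => R (x.2, y.2) (x.1, y.1)

theorem isClosedOp_of_mul_eq_one {R T : Matrix (ι × ι) (ι × ι) K}
    (h : partialTranspose R * T = 1) : IsClosedOp R := by
  have h' := mul_eq_one_comm.1 h
  refine ⟨fun x y => T (x.1, y.1) (x.2, y.2), fun i k j l => ?_, fun i k j l => ?_⟩
  · have := congrFun (congrFun h (i, j)) (k, l)
    rw [Matrix.mul_apply, Fintype.sum_prod_type] at this
    refine this.trans ?_
    simp only [Matrix.one_apply, Prod.mk.injEq]
    split_ifs <;> simp_all
  · have := congrFun (congrFun h' (j, i)) (l, k)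
    rw [Matrix.mul_apply, Fintype.sum_prod_type, Finset.sum_comm] at this
    refine this.trans ?_
    simp only [Matrix.one_apply, Prod.mk.injEq]
    split_ifs <;> simp_all

/-- `c - R` is closed if `R` is closed and its quantum dimension differs from `c⁻¹`. -/
theorem isClosedOp_smul_one_sub {R : Matrix (ι × ι) (ι × ι) K} (h : IsClosedOp R) {c : K}
    (hc : c * (traceF R).trace ≠ 1) :
    IsClosedOp (c • (1 : Matrix (ι × ι) (ι × ι) K) - R) := by
  have hS := isSkewInverse_skewInv h
  set S := skewInv R with hSdef
  let T : Matrix (ι × ι) (ι × ι) K := fun x y => S (x.1, y.1) (x.2, y.2)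
  let u : ι × ι → K := fun x => if x.1 = x.2 then 1 else 0
  have hT : partialTranspose R * T = 1 := by
    ext ⟨i, j⟩ ⟨k, l⟩
    rw [Matrix.mul_apply, Fintype.sum_prod_type]
    refine (hS.1 i k j l).trans ?_
    simp only [Matrix.one_apply, Prod.mk.injEq]
    split_ifs <;> simp_all
  have htr : u ⬝ᵥ T.mulVec u = (traceF R).trace := by
    simp only [dotProduct, Matrix.mulVec, Fintype.sum_prod_type, u, T, Matrix.trace, traceF,
      Matrix.diag_apply, ← hSdef]
    simp
    rw [Finset.sum_comm]
  have h1 : partialTranspose (1 : Matrix (ι × ι) (ι × ι) K) = Matrix.vecMulVec u u := by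
    ext ⟨i, j⟩ ⟨k, l⟩
    simp only [partialTranspose, Matrix.vecMulVec_apply, u, Matrix.one_apply, Prod.mk.injEq]
    split_ifs <;> simp_all
  have hsub : partialTranspose (c • (1 : Matrix (ι × ι) (ι × ι) K) - R) =
      c • Matrix.vecMulVec u u - partialTranspose R := by
    rw [← h1]; rfl
  have hd : 1 - c * (traceF R).trace ≠ 0 := fun h => hc (sub_eq_zero.1 h).symm
  -- The witness is the Sherman–Morrison inverse of a rank-one perturbation of `-partialTranspose
  -- R`; its denominator is `1 - c tr F`, where `F = traceF R`.
  refine isClosedOp_of_mul_eq_one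
    (T := -(T * (1 + (c * (1 - c * (traceF R).trace)⁻¹) • (Matrix.vecMulVec u u * T)))) ?_
  rw [hsub]
  set N := Matrix.vecMulVec u u * T with hN
  have hNN : N * N = (traceF R).trace • N := by
    rw [hN, Matrix.vecMulVec_mul, Matrix.vecMulVec_mul_vecMulVec, ← htr,
      Matrix.dotProduct_mulVec, Matrix.vecMulVec_smul]
  have e : (c • Matrix.vecMulVec u u - partialTranspose R) * T = c • N - 1 := by
    rw [sub_mul, hT, smul_mul_assoc]
  rw [mul_neg, ← mul_assoc, e]
  simp only [mul_add, sub_mul, mul_one, one_mul, smul_mul_assoc, mul_smul_comm, hNN, smul_smul]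
  have hcoef : c + c * (1 - c * (traceF R).trace)⁻¹ * (c * (traceF R).trace) -
      c * (1 - c * (traceF R).trace)⁻¹ = 0 := by
    field_simp
    ring
  trans 1 - (c + c * (1 - c * (traceF R).trace)⁻¹ * (c * (traceF R).trace) -
      c * (1 - c * (traceF R).trace)⁻¹) • N
  · module
  · rw [hcoef, zero_smul, sub_zero]

/-- Odd Hecke operators are closed. -/
theorem IsOddHecke.isClosedOp {q : K} (hq : q ≠ 0) {R : Matrix (ι × ι) (ι × ι) K}
    (h : IsOddHecke q R) {s : ℕ} (hs : HasOddRank q R s) : IsClosedOp R := by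
  obtain ⟨hu, he⟩ := h
  have hdet : IsUnit R.det := (Matrix.isUnit_iff_isUnit_det R).1 hu
  -- Multiplying the Hecke equation of `R' = -q R⁻¹` by `R` turns it into `q ((q - 1) - R' - R) =
  -- 0`.
  have hR : R = (q - 1) • (1 : Matrix (ι × ι) (ι × ι) K) - -(q • R⁻¹) := by
    have := congrArg (R * ·) he.hecke
    have h1 : R * R⁻¹ = 1 := Matrix.mul_nonsing_inv R hdet
    have e : R * ((-(q • R⁻¹) + 1) * (-(q • R⁻¹) - q • (1 : Matrix (ι × ι) (ι × ι) K))) =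
        q • ((q - 1) • (1 : Matrix (ι × ι) (ι × ι) K) - -(q • R⁻¹) - R) := by
      rw [← mul_assoc, mul_add, mul_neg, mul_smul_comm, h1]
      simp only [add_mul, mul_sub, mul_neg, neg_mul, smul_mul_assoc, mul_smul_comm, one_mul,
        mul_one, h1]
      module
    rw [e, mul_zero, smul_eq_zero] at this
    exact (sub_eq_zero.1 (this.resolve_left hq)).symm
  rw [hR]
  exact isClosedOp_smul_one_sub he.closed (quantumDimension_ne hq he hs)

end ClosedPerturbation

end QuantumBer

theorem mainTheorem10 {K : Type*} [Field K] [CharZero K]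
    (q : K) (hq0 : q ≠ 0) (hq : ∀ k : ℕ, 0 < k → q ^ k = 1 → q = 1)
    (m n r s : ℕ)
    (Re : Matrix (Fin m × Fin m) (Fin m × Fin m) K)
    (Ro : Matrix (Fin n × Fin n) (Fin n × Fin n) K)
    (hRe : QuantumBer.IsEvenHecke q Re) (hr : QuantumBer.HasEvenRank Re r)
    (hRo : QuantumBer.IsOddHecke q Ro) (hs : QuantumBer.HasOddRank q Ro s)
    (P : Matrix (Fin n × Fin m) (Fin m × Fin n) K)
    (Pinv : Matrix (Fin m × Fin n) (Fin n × Fin m) K)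
    (hP : P * Pinv = 1) (hP' : Pinv * P = 1)
    (hPclosed : QuantumBer.IsClosedOp P)
    (hPe : QuantumBer.onLeft (Fin m) P * QuantumBer.onRight (Fin m) P *
        QuantumBer.onLeft (Fin n) Re =
      QuantumBer.onRight (Fin n) Re * QuantumBer.onLeft (Fin m) P *
        QuantumBer.onRight (Fin m) P)
    (hPo : QuantumBer.onRight (Fin n) P * QuantumBer.onLeft (Fin n) P *
        QuantumBer.onRight (Fin m) Ro =
      QuantumBer.onLeft (Fin m) Ro * QuantumBer.onRight (Fin n) P *
        QuantumBer.onLeft (Fin n) P) :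
    Commute
      (QuantumBer.detA q Re r (QuantumBer.gluedOp q Re Ro P (q • Pinv)))
      (QuantumBer.detV q Ro s (QuantumBer.gluedOp q Re Ro P (q • Pinv))) :=
  QuantumBer.commute_detA_detV q hRe.closed (hRo.isClosedOp hq0 hs) hP hP' hPe hPo (q • Pinv) r s
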